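/- **Setting.** Let $\mathbb K=\mathbb R$ or $\mathbb C$. A *Jordan triple* is a $\mathbb K$-vector space $V$ with a product $\{\cdot,\cdot,\cdot\}:V^3\to V$ that is linear and symmetric in the outer variables, conjugate linear in the middle variable, and satisfies $$\{x,y,\{a,b,c\}\}=\{\{x,y,a\},b,c\}-\{a,\{y,x,b\},c\}+\{a,b,\{x,y,c\}\}.$$ It is *nondegenerate* if $\{a,a,a\}=0$ implies $a=0$. Write $a\,\square\, b=\{a,b,\cdot\}$ and let $V_0$ be the span of all $a\,\square\, b$ in $\mathrm{End}(V)$. For nondegenerate $V$ the operator $h^\natural=\sum_i b_i\,\square\, a_i$ is well defined for $h=\sum_i a_i\,\square\, b_i\in V_0$, and the *TKK Lie algebra* of $V$ is $\mathfrak L(V)=V\oplus V_0\oplus V$ with $$[(x,h,y),(u,k,v)]=(hu-kx,\ [h,k]+x\,\square\, v-u\,\square\, y,\ k^\natural y-h^\natural v),$$ where scalars act on the last summand through complex conjugation (so that the product is bilinear). A *triple $V$-module* is a $\mathbb K$-vector space $M$ with products $\{a,b,m\}=\{m,b,a\}\in M$ and $\{a,m,b\}=\{b,m,a\}\in M$ $(a,b\in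 V,\ m\in M)$ such that $$\{a,b,\{c,d,e\}\}=\{\{a,b,c\},d,e\}-\{c,\{b,a,d\},e\}+\{c,d,\{a,b,e\}\}$$ whenever one of the elements is in $M$ and the others are in $V$, and such that, over $\mathbb C$, one of the following holds: (A) all products are linear in the outer variables and conjugate linear in the middle one; or (B) $\{m,b,a\}$ is linear in $m,b$ and conjugate linear in $a$, and $\{a,m,b\}$ is conjugate linear in all variables. (Over $\mathbb R$ both say that the products are trilinear.) $M$ is *nondegenerate* if each of $\{m,V,V\}=0$ and $\{V,m,V\}=0$ implies $m=0$. For a nondegenerate module let $u\,\square\, m=\{u,m,\cdot\}$ and $n\,\square\, v=\{n,v,\cdot\}$ $(u,v\in V,\ m,n\in M)$, viewed as maps $V\to M$, let $M_0$ be their span, and let $\varphi^\natural=\sum_i m_i\,\square\, u_i+\sum_j v_j\,\square\, n_j$ for $\varphi=\sum_i u_i\,\square\, m_i+\sum_j n_j\,\square\, v_j\in M_0$ (this is well defined). Let $\mathfrak L(V)$ act on $\mathfrak L(M)=M\oplus M_0\oplus M$ by $$(a,h,b).(m,\varphi,n)=(hm-\varphi a,\ [h,\varphi]+a\,\square\,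 n-m\,\square\, b,\ \varphi^\natural b-h^\natural n),\qquad hm=\sum_i\{a_i,b_i,m\}\ \text{ for } h=\sum_i a_i\,\square\, b_i,$$ with $[h,\varphi]=h\varphi-\varphi h$. The scalar action on $\mathfrak L(M)$ is $c(m,\varphi,n)=(cm,c\varphi,\bar cn)$ in case (A) and $c(m,\varphi,n)=(\bar cm,\bar c\varphi,cn)$ in case (B). Let $A^k$ be the space of alternating $k$-linear maps $\mathfrak L(V)^k\to\mathfrak L(M)$, $A^0=\mathfrak L(M)$, with the usual coboundary $d_k:A^k\to A^{k+1}$ of Lie algebra cohomology. For $\psi\in A^k$ let $J^k\psi(v_1,\dots,v_k)\in M$ be the first component of $\psi((v_1,0,0),\dots,(v_k,0,0))$. For $k\ge1$ put $$H^k(V,M)=J^k(\ker d_k)\,/\,J^k(\operatorname{im} d_{k-1}).$$ A *triple derivation* $\omega:V\to M$ is a linear (case (A)), respectively conjugate linear (case (B)), map with $\omega\{a,b,c\}=\{\omega(a),b,c\}+\{a,\omega(b),c\}+\{a,b,\omega(c)\}$; it is *inner* if $\omega=\sum_{i=1}^k(m_i\,\square\, v_i-v_i\,\square\, m_i)$ for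 some $m_i\in M$, $v_i\in V$. **Statement.** Let $V$ be a finite-dimensional nondegenerate Jordan triple whose TKK Lie algebra $\mathfrak L(V)$ is semisimple, and let $M$ be a finite-dimensional nondegenerate triple $V$-module. Then the action of $V_0$ on $M$ is well defined (if $\sum_i a_i\,\square\, b_i=0$ on $V$, then $\sum_i\{a_i,b_i,m\}=0$ for all $m\in M$), and $$H^1(V,M)=H^2(V,M)=\{0\}.$$ In particular, every triple derivation from $V$ to $M$ is inner. -/

import Mathlib

open scoped ComplexConjugate

noncomputable section

/-! ### Jordan triples -/

/-- A real or complex Jordan triple: a vector space `V` over `𝕜 = ℝ` or `𝕜 = ℂ` with a triple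
product `tp a b c = {a,b,c}` which is linear and symmetric in the outer variables, conjugate linear
in the middle variable, and satisfies the Jordan triple identity. -/
structure JordanTriple (𝕜 V : Type*) [RCLike 𝕜] [AddCommGroup V] [Module 𝕜 V] where
  tp : V →ₗ[𝕜] V →ₗ⋆[𝕜] V →ₗ[𝕜] V
  tp_symm : ∀ a b c, tp a b c = tp c b a
  jordan : ∀ x y a b c,
    tp x y (tp a b c) = tp (tp x y a) b c - tp a (tp y x b) c + tp a b (tp x y c)

namespace JordanTriple

variable {𝕜 V : Type*} [RCLike 𝕜] [AddCommGroup V] [Module 𝕜 V] (T : JordanTriple 𝕜 V)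

/-- `{a,a,a} = 0` implies `a = 0`. -/
class Nondegenerate : Prop where
  eq_zero : ∀ a, T.tp a a a = 0 → a = 0

/-- The sum `∑ aᵢ □ bᵢ` of box operators over a finite list of pairs `(aᵢ, bᵢ)`, where
`a □ b = {a,b,·}`. -/
def boxSum (l : List (V × V)) : V →ₗ[𝕜] V := (l.map fun p => T.tp p.1 p.2).sum

@[simp] theorem boxSum_nil : T.boxSum [] = 0 := rfl

@[simp] theorem boxSum_cons (p : V × V) (l : List (V × V)) :
    T.boxSum (p :: l) = T.tp p.1 p.2 + T.boxSum l := by simp [boxSum]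

@[simp] theorem boxSum_append (l l' : List (V × V)) :
    T.boxSum (l ++ l') = T.boxSum l + T.boxSum l' := by simp [boxSum]

/-- The space `V₀` spanned by the box operators `a □ b : V → V`. -/
def V0 : Submodule 𝕜 (V →ₗ[𝕜] V) :=
  Submodule.span 𝕜 (Set.range fun p : V × V => T.tp p.1 p.2)

theorem tp_mem (a b : V) : T.tp a b ∈ T.V0 := Submodule.subset_span ⟨(a, b), rfl⟩

theorem boxSum_mem (l : List (V × V)) : T.boxSum l ∈ T.V0 := by
  induction l with
  | nil => exact T.V0.zero_mem
  | cons p l ih => rw [boxSum_cons]; exact T.V0.add_mem (T.tp_mem _ _) ih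

theorem boxSum_smul (c : 𝕜) (l : List (V × V)) :
    T.boxSum (l.map fun p => (c • p.1, p.2)) = c • T.boxSum l := by
  induction l with
  | nil => simp
  | cons p l ih => simp [ih]

theorem exists_boxSum (h : T.V0) : ∃ l, T.boxSum l = h.1 := by
  obtain ⟨h, hh⟩ := h
  induction hh using Submodule.span_induction with
  | mem x hx => obtain ⟨p, rfl⟩ := hx; exact ⟨[p], by simp⟩
  | zero => exact ⟨[], rfl⟩
  | add x y _ _ hx hy =>
    obtain ⟨l, hl⟩ := hx
    obtain ⟨l', hl'⟩ := hy
    exact ⟨l ++ l', by simp_all⟩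
  | smul c x _ hx =>
    obtain ⟨l, hl⟩ := hx
    exact ⟨l.map fun p => (c • p.1, p.2), by rw [boxSum_smul, hl]⟩

/-- A chosen expression of `h ∈ V₀` as a finite sum `∑ aᵢ □ bᵢ`. -/
def rep (h : T.V0) : List (V × V) := (T.exists_boxSum h).choose

theorem boxSum_rep (h : T.V0) : T.boxSum (T.rep h) = h.1 := (T.exists_boxSum h).choose_spec

/-- The operator `h^♮ = ∑ bᵢ □ aᵢ` for `h = ∑ aᵢ □ bᵢ ∈ V₀`. It does not depend on the chosen
expression when the triple is nondegenerate, see `natural_eq`. -/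
def natural (h : T.V0) : T.V0 := ⟨T.boxSum ((T.rep h).map Prod.swap), T.boxSum_mem _⟩

theorem boxSum_comm (l : List (V × V)) (c d x : V) :
    T.boxSum l (T.tp c d x) =
      T.tp (T.boxSum l c) d x - T.tp c (T.boxSum (l.map Prod.swap) d) x
        + T.tp c d (T.boxSum l x) := by
  induction l with
  | nil => simp
  | cons p l ih =>
    simp only [boxSum_cons, LinearMap.add_apply, map_add, List.map_cons, Prod.fst_swap,
      Prod.snd_swap, ih]
    rw [T.jordan]
    abel

theorem boxSum_swap_eq_zero [T.Nondegenerate] (l : List (V × V)) (h : T.boxSum l = 0) :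
    T.boxSum (l.map Prod.swap) = 0 := by
  ext d
  apply Nondegenerate.eq_zero (T := T)
  have := T.boxSum_comm l (T.boxSum (l.map Prod.swap) d) d (T.boxSum (l.map Prod.swap) d)
  simpa [h] using this

theorem boxSum_neg (l : List (V × V)) :
    T.boxSum (l.map fun p => (-p.1, p.2)) = - T.boxSum l := by
  induction l with
  | nil => simp
  | cons p l ih => simp [ih]; abel

theorem boxSum_swap_congr [T.Nondegenerate] {l l' : List (V × V)}
    (h : T.boxSum l = T.boxSum l') :
    T.boxSum (l.map Prod.swap) = T.boxSum (l'.map Prod.swap) := by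
  have h2 := T.boxSum_swap_eq_zero (l ++ l'.map fun p => (-p.1, p.2)) (by
    rw [boxSum_append, boxSum_neg, h, add_neg_cancel])
  have h3 : ∀ k : List (V × V), T.boxSum ((k.map fun p => (-p.1, p.2)).map Prod.swap)
      = - T.boxSum (k.map Prod.swap) := by
    intro k
    induction k with
    | nil => simp
    | cons p k ih => simp_all; abel
  rw [List.map_append, boxSum_append, h3] at h2
  exact add_neg_eq_zero.mp h2

theorem natural_eq [T.Nondegenerate] (h : T.V0) (l : List (V × V)) (hl : T.boxSum l = h.1) :
    (T.natural h).1 = T.boxSum (l.map Prod.swap) :=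
  T.boxSum_swap_congr ((T.boxSum_rep h).trans hl.symm)

/-- The box operator `a □ b` as an element of `V₀`. -/
def box (a b : V) : T.V0 := ⟨T.tp a b, T.tp_mem a b⟩

theorem V0_comm (h : T.V0) (c d x : V) :
    h.1 (T.tp c d x) =
      T.tp (h.1 c) d x - T.tp c ((T.natural h).1 d) x + T.tp c d (h.1 x) := by
  have := T.boxSum_comm (T.rep h) c d x
  rwa [boxSum_rep] at this

theorem natural_add [T.Nondegenerate] (h k : T.V0) :
    T.natural (h + k) = T.natural h + T.natural k := by
  apply Subtype.ext
  rw [T.natural_eq (h + k) (T.rep h ++ T.rep k) (by simp [boxSum_rep])]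
  simp [natural]

theorem natural_smul [T.Nondegenerate] (c : 𝕜) (h : T.V0) :
    T.natural (c • h) = conj c • T.natural h := by
  apply Subtype.ext
  rw [T.natural_eq (c • h) ((T.rep h).map fun p => (c • p.1, p.2))
    (by simp [boxSum_rep, boxSum_smul])]
  simp only [natural, Submodule.coe_smul]
  induction T.rep h with
  | nil => simp
  | cons p l ih => simp_all

theorem natural_box [T.Nondegenerate] (a b : V) : T.natural (T.box a b) = T.box b a := by
  apply Subtype.ext
  rw [T.natural_eq (T.box a b) [(a, b)] (by simp [box])]
  simp [box]

theorem natural_natural [T.Nondegenerate] (h : T.V0) : T.natural (T.natural h) = h := by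
  apply Subtype.ext
  rw [T.natural_eq (T.natural h) ((T.rep h).map Prod.swap) rfl]
  simp [boxSum_rep]

theorem natural_neg [T.Nondegenerate] (h : T.V0) : T.natural (-h) = -T.natural h := by
  have h0 : T.natural 0 = 0 := by simpa using T.natural_add 0 0
  apply eq_neg_of_add_eq_zero_left
  rw [← natural_add, neg_add_cancel, h0]

theorem natural_sub [T.Nondegenerate] (h k : T.V0) :
    T.natural (h - k) = T.natural h - T.natural k := by
  rw [sub_eq_add_neg, natural_add, natural_neg, sub_eq_add_neg]

theorem comm_eq (h : T.V0) (l : List (V × V)) :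
    h.1 ∘ₗ T.boxSum l - T.boxSum l ∘ₗ h.1 =
      T.boxSum (l.flatMap fun p => [(h.1 p.1, p.2), (-p.1, (T.natural h).1 p.2)]) := by
  induction l with
  | nil => simp
  | cons p l ih =>
    ext x
    have := LinearMap.congr_fun ih x
    simp only [LinearMap.sub_apply, LinearMap.comp_apply] at this
    simp only [boxSum_cons, List.flatMap_cons, boxSum_append, LinearMap.sub_apply,
      LinearMap.comp_apply, LinearMap.add_apply, map_add, V0_comm, ← this, boxSum_nil,
      LinearMap.zero_apply, map_neg, LinearMap.neg_apply]
    abel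

/-- The commutator `[h,k] = hk - kh` on `V₀`. -/
def comm (h k : T.V0) : T.V0 := ⟨h.1 ∘ₗ k.1 - k.1 ∘ₗ h.1, by
  rw [← T.boxSum_rep k, comm_eq]; exact T.boxSum_mem _⟩

theorem comm_box (h : T.V0) (c d : V) :
    T.comm h (T.box c d) = T.box (h.1 c) d - T.box c ((T.natural h).1 d) := by
  apply Subtype.ext
  ext x
  simp [comm, box, V0_comm]

theorem V0_induction {P : T.V0 → Prop} (zero : P 0)
    (add : ∀ a b h, P h → P (T.box a b + h)) (h : T.V0) : P h := by
  have key : ∀ l, P ⟨T.boxSum l, T.boxSum_mem l⟩ := by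
    intro l
    induction l with
    | nil => exact zero
    | cons p l ih =>
      convert add p.1 p.2 _ ih using 1
      apply Subtype.ext
      simp [box]
  have := key (T.rep h)
  simpa [boxSum_rep] using this

theorem comm_add (h k k' : T.V0) : T.comm h (k + k') = T.comm h k + T.comm h k' := by
  apply Subtype.ext
  ext x
  simp [comm]
  abel

theorem natural_comm [T.Nondegenerate] (h k : T.V0) :
    T.natural (T.comm h k) = - T.comm (T.natural h) (T.natural k) := by
  induction k using V0_induction with
  | zero =>
    have h0 : T.natural 0 = 0 := by simpa using T.natural_add 0 0
    have h1 : ∀ k, T.comm k 0 = 0 := fun k => by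
      apply Subtype.ext
      simp [comm]
    rw [h1, h0, h1, neg_zero]
  | add a b k ih =>
    rw [comm_add, natural_add, natural_add, comm_add, ih, comm_box, natural_box, comm_box,
      natural_sub, natural_box, natural_box, natural_natural]
    abel

/-! ### The TKK Lie algebra -/

/-- The Tits-Kantor-Koecher Lie algebra `𝔏(V) = V ⊕ V₀ ⊕ V`. -/
def TKK : Type _ := V × T.V0 × V

instance : AddCommGroup T.TKK := inferInstanceAs (AddCommGroup (V × T.V0 × V))

/-- Scalars act on the third summand through complex conjugation (which is trivial over `ℝ`):
this is the structure for which the Lie product below is bilinear. -/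
instance : Module 𝕜 T.TKK where
  smul c x := (c • x.1, c • x.2.1, conj c • x.2.2)
  one_smul x := by
    change ((1 : 𝕜) • x.1, (1 : 𝕜) • x.2.1, conj (1 : 𝕜) • x.2.2) = x
    simp only [one_smul, map_one]
    rfl
  mul_smul c d x := by
    change ((c * d) • x.1, (c * d) • x.2.1, conj (c * d) • x.2.2)
      = (c • d • x.1, c • d • x.2.1, conj c • conj d • x.2.2)
    simp [mul_smul]
  smul_zero c := by
    change ((c • 0, c • 0, conj c • 0) : V × T.V0 × V) = 0
    simp
  smul_add c x y := by
    change (c • (x.1 + y.1), c • (x.2.1 + y.2.1), conj c • (x.2.2 + y.2.2))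
      = (c • x.1 + c • y.1, c • x.2.1 + c • y.2.1, conj c • x.2.2 + conj c • y.2.2)
    simp
  add_smul c d x := by
    change ((c + d) • x.1, (c + d) • x.2.1, conj (c + d) • x.2.2)
      = (c • x.1 + d • x.1, c • x.2.1 + d • x.2.1, conj c • x.2.2 + conj d • x.2.2)
    simp [add_smul]
  zero_smul x := by
    change ((0 : 𝕜) • x.1, (0 : 𝕜) • x.2.1, conj (0 : 𝕜) • x.2.2) = (0, 0, 0)
    simp

/-- `[(x,h,y),(u,k,v)] = (hu - kx, [h,k] + x □ v - u □ y, k^♮ y - h^♮ v)`. -/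
instance : Bracket T.TKK T.TKK where
  bracket p q := (p.2.1.1 q.1 - q.2.1.1 p.1,
    T.comm p.2.1 q.2.1 + T.box p.1 q.2.2 - T.box q.1 p.2.2,
    (T.natural q.2.1).1 p.2.2 - (T.natural p.2.1).1 q.2.2)

theorem TKK_ext {p q : T.TKK} (h1 : p.1 = q.1) (h2 : ∀ x, p.2.1.1 x = q.2.1.1 x)
    (h3 : p.2.2 = q.2.2) : p = q :=
  Prod.ext h1 (Prod.ext (Subtype.ext (LinearMap.ext h2)) h3)

@[simp] theorem bracket_fst (p q : T.TKK) : ⁅p, q⁆.1 = p.2.1.1 q.1 - q.2.1.1 p.1 := rfl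

@[simp] theorem bracket_mid (p q : T.TKK) :
    ⁅p, q⁆.2.1 = T.comm p.2.1 q.2.1 + T.box p.1 q.2.2 - T.box q.1 p.2.2 := rfl

@[simp] theorem bracket_snd (p q : T.TKK) :
    ⁅p, q⁆.2.2 = (T.natural q.2.1).1 p.2.2 - (T.natural p.2.1).1 q.2.2 := rfl

@[simp] theorem add_fst (p q : T.TKK) : (p + q).1 = p.1 + q.1 := rfl
@[simp] theorem add_mid (p q : T.TKK) : (p + q).2.1 = p.2.1 + q.2.1 := rfl
@[simp] theorem add_snd (p q : T.TKK) : (p + q).2.2 = p.2.2 + q.2.2 := rfl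
@[simp] theorem smul_fst (c : 𝕜) (p : T.TKK) : (c • p).1 = c • p.1 := rfl
@[simp] theorem smul_mid (c : 𝕜) (p : T.TKK) : (c • p).2.1 = c • p.2.1 := rfl
@[simp] theorem smul_snd (c : 𝕜) (p : T.TKK) : (c • p).2.2 = conj c • p.2.2 := rfl
@[simp] theorem zero_fst : (0 : T.TKK).1 = 0 := rfl
@[simp] theorem zero_mid : (0 : T.TKK).2.1 = 0 := rfl
@[simp] theorem zero_snd : (0 : T.TKK).2.2 = 0 := rfl

@[simp] theorem comm_apply (h k : T.V0) (x : V) :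
    (T.comm h k).1 x = h.1 (k.1 x) - k.1 (h.1 x) := rfl

@[simp] theorem box_apply (a b x : V) : (T.box a b).1 x = T.tp a b x := rfl

instance [T.Nondegenerate] : LieRing T.TKK where
  add_lie p q r := by
    apply T.TKK_ext
    · simp; abel
    · intro x; simp; abel
    · simp [natural_add]; abel
  lie_add p q r := by
    apply T.TKK_ext
    · simp; abel
    · intro x; simp; abel
    · simp [natural_add]; abel
  lie_self p := by
    apply T.TKK_ext
    · simp
    · intro x; simp
    · simp
  leibniz_lie p q r := by
    apply T.TKK_ext
    · simp only [bracket_fst, bracket_mid, add_fst, map_sub, Submodule.coe_add,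
        Submodule.coe_sub, LinearMap.add_apply, LinearMap.sub_apply, comm_apply, box_apply]
      rw [T.tp_symm r.1 q.2.2 p.1, T.tp_symm q.1 r.2.2 p.1, T.tp_symm r.1 p.2.2 q.1]
      abel
    · intro x
      simp only [bracket_fst, bracket_mid, bracket_snd, add_mid, map_sub, map_add,
        Submodule.coe_add, Submodule.coe_sub, LinearMap.add_apply, LinearMap.sub_apply,
        comm_apply, box_apply, V0_comm]
      abel
    · simp only [bracket_mid, bracket_snd, add_snd, map_sub, natural_add,
        natural_sub, natural_comm, natural_box, Submodule.coe_add, Submodule.coe_sub,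
        LinearMap.add_apply, LinearMap.sub_apply, LinearMap.neg_apply, Submodule.coe_neg,
        comm_apply, box_apply]
      rw [T.tp_symm r.2.2 q.1 p.2.2, T.tp_symm q.2.2 r.1 p.2.2, T.tp_symm q.2.2 p.1 r.2.2]
      abel

instance [T.Nondegenerate] : LieAlgebra 𝕜 T.TKK where
  lie_smul c p q := by
    apply T.TKK_ext
    · simp [smul_sub]
    · intro x; simp [smul_sub]
    · simp [smul_sub, natural_smul]

/-! ### Triple modules -/

/-- A triple `V`-module `M`, with products `tp₃ a b m = {a,b,m}`, `tp₂ a m b = {a,m,b}` and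
`{m,b,a} = {a,b,m}`. The field homomorphism `τ` is the identity or complex conjugation, so that two
kinds of modules are covered: for `τ = id` the products obey the rule of the triple product itself
(linear in the outer variables, conjugate linear in the middle one; `V` is such a module over
itself), for `τ = conj` the product `{m,b,a}` is linear in `m`, `b` and conjugate linear in `a`, and
`{a,m,b}` is conjugate linear in all variables (the dual of `V` is of this kind). Over `ℝ` there is
no difference. The last four fields say that
`{a,b,{c,d,e}} = {{a,b,c},d,e} - {c,{b,a,d},e} + {c,d,{a,b,e}}`
holds if one of `a`, `b`, `d`, `e` is in `M` and the others in `V`; by the outer symmetry the case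
`c ∈ M` is the same as the case `e ∈ M`. -/
structure TripleModule (τ : 𝕜 →+* 𝕜) (M : Type*) [AddCommGroup M] [Module 𝕜 M] where
  tp₃ : V →ₛₗ[τ] V →ₛₗ[τ.comp (starRingEnd 𝕜)] M →ₗ[𝕜] M
  tp₂ : V →ₛₗ[τ] M →ₗ⋆[𝕜] V →ₛₗ[τ] M
  tp₂_symm : ∀ a m c, tp₂ a m c = tp₂ c m a
  jordan₁ : ∀ m b c d e, tp₃ (T.tp c d e) b m =
    tp₃ e d (tp₃ c b m) - tp₂ c (tp₂ b m d) e + tp₃ c d (tp₃ e b m)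
  jordan₂ : ∀ a m c d e, tp₂ a m (T.tp c d e) =
    tp₃ e d (tp₂ a m c) - tp₂ c (tp₃ d a m) e + tp₃ c d (tp₂ a m e)
  jordan₄ : ∀ a b c m e, tp₃ a b (tp₂ c m e) =
    tp₂ (T.tp a b c) m e - tp₂ c (tp₃ b a m) e + tp₂ c m (T.tp a b e)
  jordan₅ : ∀ a b c d m, tp₃ a b (tp₃ c d m) =
    tp₃ (T.tp a b c) d m - tp₃ c (T.tp b a d) m + tp₃ c d (tp₃ a b m)

namespace TripleModule

variable {T} {τ : 𝕜 →+* 𝕜} {M : Type*} [AddCommGroup M] [Module 𝕜 M] (W : T.TripleModule τ M)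

/-- Each of the conditions `{m,V,V} = 0` and `{V,m,V} = 0` implies `m = 0`. -/
class Nondegenerate : Prop where
  eq_zero₁ : ∀ m, (∀ a b, W.tp₃ a b m = 0) → m = 0
  eq_zero₂ : ∀ m, (∀ a b, W.tp₂ a m b = 0) → m = 0

/-- The operator `m □ b : v ↦ {m,b,v}` from `V` to `M`. -/
def mBox (m : M) (b : V) : V →ₛₗ[τ] M where
  toFun v := W.tp₃ v b m
  map_add' := by simp
  map_smul' := by simp

/-- The sum `∑ uᵢ □ mᵢ + ∑ nⱼ □ vⱼ : V → M`, over finite lists of pairs `(uᵢ, mᵢ)` and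
`(nⱼ, vⱼ)`, where `u □ m = {u,m,·}` and `n □ v = {n,v,·}`. -/
def boxSum (l : List (V × M) × List (M × V)) : V →ₛₗ[τ] M :=
  (l.1.map fun p => W.tp₂ p.1 p.2).sum + (l.2.map fun p => W.mBox p.1 p.2).sum

/-- The space `M₀` spanned by the operators `u □ m` and `n □ v` from `V` to `M`. -/
def M0 : Submodule 𝕜 (V →ₛₗ[τ] M) :=
  Submodule.span 𝕜 ((Set.range fun p : V × M => W.tp₂ p.1 p.2) ∪
    (Set.range fun p : M × V => W.mBox p.1 p.2))

theorem tp₂_mem (u : V) (m : M) : W.tp₂ u m ∈ W.M0 :=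
  Submodule.subset_span (Or.inl ⟨(u, m), rfl⟩)

theorem mBox_mem (n : M) (v : V) : W.mBox n v ∈ W.M0 :=
  Submodule.subset_span (Or.inr ⟨(n, v), rfl⟩)

@[simp] theorem mBox_apply (m : M) (b v : V) : W.mBox m b v = W.tp₃ v b m := rfl

/-- The pair of lists describing `φ^♮ = ∑ mᵢ □ uᵢ + ∑ vⱼ □ nⱼ` for
`φ = ∑ uᵢ □ mᵢ + ∑ nⱼ □ vⱼ`. -/
def swapLists (l : List (V × M) × List (M × V)) : List (V × M) × List (M × V) :=
  (l.2.map Prod.swap, l.1.map Prod.swap)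

theorem boxSum_mem (l : List (V × M) × List (M × V)) : W.boxSum l ∈ W.M0 := by
  apply W.M0.add_mem
  · apply list_sum_mem
    intro x hx
    obtain ⟨p, -, rfl⟩ := List.mem_map.mp hx
    exact W.tp₂_mem _ _
  · apply list_sum_mem
    intro x hx
    obtain ⟨p, -, rfl⟩ := List.mem_map.mp hx
    exact W.mBox_mem _ _

theorem boxSum_append (l l' : List (V × M) × List (M × V)) :
    W.boxSum (l.1 ++ l'.1, l.2 ++ l'.2) = W.boxSum l + W.boxSum l' := by
  simp only [boxSum, List.map_append, List.sum_append]
  abel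

/-- Rescaling of an expression. -/
def smulLists (c : 𝕜) (l : List (V × M) × List (M × V)) : List (V × M) × List (M × V) :=
  (l.1.map fun p => (p.1, conj c • p.2), l.2.map fun p => (c • p.1, p.2))

theorem boxSum_smul (c : 𝕜) (l : List (V × M) × List (M × V)) :
    W.boxSum (smulLists c l) = c • W.boxSum l := by
  obtain ⟨l₁, l₂⟩ := l
  simp only [boxSum, smulLists, smul_add, List.map_map]
  congr 1
  · induction l₁ with
    | nil => simp
    | cons p l ih => simp_all
  · induction l₂ with
    | nil => simp
    | cons p l ih =>
      have : W.mBox (c • p.1) p.2 = c • W.mBox p.1 p.2 := by ext; simp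
      simp_all

theorem exists_boxSum (φ : W.M0) : ∃ l, W.boxSum l = φ.1 := by
  obtain ⟨φ, hφ⟩ := φ
  induction hφ using Submodule.span_induction with
  | mem x hx =>
    obtain ⟨p, rfl⟩ | ⟨p, rfl⟩ := hx
    · exact ⟨([p], []), by simp [boxSum]⟩
    · exact ⟨([], [p]), by simp [boxSum]⟩
  | zero => exact ⟨([], []), by simp [boxSum]⟩
  | add x y _ _ hx hy =>
    obtain ⟨l, hl⟩ := hx
    obtain ⟨l', hl'⟩ := hy
    exact ⟨_, (W.boxSum_append l l').trans (by simp_all)⟩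
  | smul c x _ hx =>
    obtain ⟨l, hl⟩ := hx
    exact ⟨smulLists c l, by rw [boxSum_smul, hl]⟩

/-- A chosen expression of `φ ∈ M₀` as `∑ uᵢ □ mᵢ + ∑ nⱼ □ vⱼ`. -/
def rep (φ : W.M0) : List (V × M) × List (M × V) := (W.exists_boxSum φ).choose

theorem boxSum_rep (φ : W.M0) : W.boxSum (W.rep φ) = φ.1 := (W.exists_boxSum φ).choose_spec

/-- The operator `φ^♮ = ∑ mᵢ □ uᵢ + ∑ vⱼ □ nⱼ` for `φ = ∑ uᵢ □ mᵢ + ∑ nⱼ □ vⱼ ∈ M₀`. It does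
not depend on the chosen expression when the module is nondegenerate, see `natural_eq`. -/
def natural (φ : W.M0) : W.M0 := ⟨W.boxSum (swapLists (W.rep φ)), W.boxSum_mem _⟩

theorem boxSum_comm (l : List (V × M) × List (M × V)) (c d e : V) :
    W.boxSum l (T.tp c d e) =
      W.tp₃ e d (W.boxSum l c) - W.tp₂ c (W.boxSum (swapLists l) d) e
        + W.tp₃ c d (W.boxSum l e) := by
  obtain ⟨l₁, l₂⟩ := l
  have h1 : (l₁.map fun p => W.tp₂ p.1 p.2).sum (T.tp c d e) =
      W.tp₃ e d ((l₁.map fun p => W.tp₂ p.1 p.2).sum c)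
        - W.tp₂ c (((l₁.map Prod.swap).map fun p => W.mBox p.1 p.2).sum d) e
        + W.tp₃ c d ((l₁.map fun p => W.tp₂ p.1 p.2).sum e) := by
    induction l₁ with
    | nil => simp
    | cons p l ih =>
      simp only [List.map_cons, List.sum_cons, LinearMap.add_apply, map_add, ih, W.jordan₂,
        mBox_apply, Prod.fst_swap, Prod.snd_swap]
      abel
  have h2 : (l₂.map fun p => W.mBox p.1 p.2).sum (T.tp c d e) =
      W.tp₃ e d ((l₂.map fun p => W.mBox p.1 p.2).sum c)
        - W.tp₂ c (((l₂.map Prod.swap).map fun p => W.tp₂ p.1 p.2).sum d) e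
        + W.tp₃ c d ((l₂.map fun p => W.mBox p.1 p.2).sum e) := by
    induction l₂ with
    | nil => simp
    | cons p l ih =>
      simp only [List.map_cons, List.sum_cons, LinearMap.add_apply, map_add, ih, W.jordan₁,
        mBox_apply, Prod.fst_swap, Prod.snd_swap]
      abel
  simp only [boxSum, swapLists, LinearMap.add_apply, map_add, h1, h2]
  abel

theorem swapLists_append {V M : Type*} (l l' : List (V × M) × List (M × V)) :
    swapLists (l.1 ++ l'.1, l.2 ++ l'.2) =
      ((swapLists l).1 ++ (swapLists l').1, (swapLists l).2 ++ (swapLists l').2) := by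
  simp [swapLists]

theorem boxSum_swap_smul (c : 𝕜) (l : List (V × M) × List (M × V)) :
    W.boxSum (swapLists (smulLists c l)) = conj c • W.boxSum (swapLists l) := by
  rw [← boxSum_smul]
  congr 1
  simp [swapLists, smulLists, Function.comp_def]

theorem boxSum_swap_congr [W.Nondegenerate] {l l' : List (V × M) × List (M × V)}
    (h : W.boxSum l = W.boxSum l') : W.boxSum (swapLists l) = W.boxSum (swapLists l') := by
  ext d
  rw [← sub_eq_zero]
  apply Nondegenerate.eq_zero₂ (W := W)
  intro c e
  have h1 := W.boxSum_comm l c d e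
  have h2 := W.boxSum_comm l' c d e
  rw [h, h2] at h1
  simp only [add_left_inj, sub_right_inj] at h1
  simp [h1]

theorem natural_eq [W.Nondegenerate] (φ : W.M0) (l : List (V × M) × List (M × V))
    (hl : W.boxSum l = φ.1) : (W.natural φ).1 = W.boxSum (swapLists l) :=
  W.boxSum_swap_congr ((W.boxSum_rep φ).trans hl.symm)

theorem natural_add [W.Nondegenerate] (φ ψ : W.M0) :
    W.natural (φ + ψ) = W.natural φ + W.natural ψ := by
  apply Subtype.ext
  rw [W.natural_eq (φ + ψ) _ ((W.boxSum_append (W.rep φ) (W.rep ψ)).trans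
    (by simp [boxSum_rep])), swapLists_append, boxSum_append]
  rfl

/-- The operator `∑ {aᵢ,bᵢ,·}` on `M`, over a finite list of pairs `(aᵢ, bᵢ)`. -/
def opSum (l : List (V × V)) : M →ₗ[𝕜] M := (l.map fun p => W.tp₃ p.1 p.2).sum

/-- The action `hm = ∑ {aᵢ,bᵢ,m}` of `h = ∑ aᵢ □ bᵢ ∈ V₀` on `M`, computed from a chosen
expression of `h`. It does not depend on the choice if and only if `W.OpWellDefined`. -/
def op (h : T.V0) : M →ₗ[𝕜] M := W.opSum (T.rep h)

/-- The action of `V₀` on `M` is well defined: if `∑ aᵢ □ bᵢ = 0` on `V`, then `∑ {aᵢ,bᵢ,m} = 0`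
for all `m ∈ M`. -/
def OpWellDefined : Prop := ∀ l : List (V × V), T.boxSum l = 0 → W.opSum l = 0

theorem opSum_tp₂ (l : List (V × V)) (u : V) (m : M) (x : V) :
    W.opSum l (W.tp₂ u m x) = W.tp₂ (T.boxSum l u) m x
      - W.tp₂ u (W.opSum (l.map Prod.swap) m) x + W.tp₂ u m (T.boxSum l x) := by
  induction l with
  | nil => simp [opSum]
  | cons p l ih =>
    simp only [opSum, List.map_cons, List.sum_cons, LinearMap.add_apply, boxSum_cons,
      W.jordan₄, map_add, Prod.fst_swap, Prod.snd_swap] at ih ⊢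
    rw [ih]
    abel

theorem opSum_tp₃ (l : List (V × V)) (x v : V) (n : M) :
    W.opSum l (W.tp₃ x v n) = W.tp₃ (T.boxSum l x) v n
      - W.tp₃ x (T.boxSum (l.map Prod.swap) v) n + W.tp₃ x v (W.opSum l n) := by
  induction l with
  | nil => simp [opSum]
  | cons p l ih =>
    simp only [opSum, List.map_cons, List.sum_cons, LinearMap.add_apply, boxSum_cons,
      map_add, Prod.fst_swap, Prod.snd_swap] at ih ⊢
    rw [ih, W.jordan₅]
    abel

theorem op_comm_mem (h : T.V0) (φ : W.M0) :
    (W.op h).comp φ.1 - φ.1.comp h.1 ∈ W.M0 := by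
  obtain ⟨φ, hφ⟩ := φ
  induction hφ using Submodule.span_induction with
  | mem x hx =>
    obtain ⟨⟨u, m⟩, rfl⟩ | ⟨⟨n, v⟩, rfl⟩ := hx
    · convert W.M0.sub_mem (W.tp₂_mem (h.1 u) m)
        (W.tp₂_mem u (W.opSum ((T.rep h).map Prod.swap) m)) using 1
      ext x
      simp [op, opSum_tp₂, T.boxSum_rep]
    · convert W.M0.sub_mem (W.mBox_mem (W.op h n) v)
        (W.mBox_mem n (T.boxSum ((T.rep h).map Prod.swap) v)) using 1
      ext x
      simp [op, opSum_tp₃, T.boxSum_rep]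
      abel
  | zero => simp
  | add x y _ _ hx hy =>
    convert W.M0.add_mem hx hy using 1
    ext z
    simp
    abel
  | smul c x _ hx =>
    convert W.M0.smul_mem c hx using 1
    ext z
    simp [smul_sub]

/-- The commutator `[h,φ] = hφ - φh` for `h ∈ V₀` and `φ ∈ M₀`. -/
def comm (h : T.V0) (φ : W.M0) : W.M0 := ⟨(W.op h).comp φ.1 - φ.1.comp h.1, W.op_comm_mem h φ⟩

/-! ### The module `𝔏(M)` -/

/-- The space `𝔏(M) = M ⊕ M₀ ⊕ M`. -/
def L : Type _ := M × W.M0 × M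

instance : AddCommGroup W.L := inferInstanceAs (AddCommGroup (M × W.M0 × M))

/-- Scalars act by `c(m,φ,n) = (τ(c)m, τ(c)φ, conj(τ(c))n)`, for which the action of `𝔏(V)` below is
bilinear. Over `ℝ` this is the obvious structure. -/
instance : Module 𝕜 W.L where
  smul c x := (τ c • x.1, τ c • x.2.1, conj (τ c) • x.2.2)
  one_smul x := by
    change (τ 1 • x.1, τ 1 • x.2.1, conj (τ 1) • x.2.2) = x
    simp only [one_smul, map_one]
    rfl
  mul_smul c d x := by
    change (τ (c * d) • x.1, τ (c * d) • x.2.1, conj (τ (c * d)) • x.2.2)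
      = (τ c • τ d • x.1, τ c • τ d • x.2.1, conj (τ c) • conj (τ d) • x.2.2)
    simp [mul_smul]
  smul_zero c := by
    change ((τ c • 0, τ c • 0, conj (τ c) • 0) : M × W.M0 × M) = 0
    simp
  smul_add c x y := by
    change (τ c • (x.1 + y.1), τ c • (x.2.1 + y.2.1), conj (τ c) • (x.2.2 + y.2.2))
      = (τ c • x.1 + τ c • y.1, τ c • x.2.1 + τ c • y.2.1,
        conj (τ c) • x.2.2 + conj (τ c) • y.2.2)
    simp
  add_smul c d x := by
    change (τ (c + d) • x.1, τ (c + d) • x.2.1, conj (τ (c + d)) • x.2.2)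
      = (τ c • x.1 + τ d • x.1, τ c • x.2.1 + τ d • x.2.1,
        conj (τ c) • x.2.2 + conj (τ d) • x.2.2)
    simp [add_smul]
  zero_smul x := by
    change (τ 0 • x.1, τ 0 • x.2.1, conj (τ 0) • x.2.2) = (0, 0, 0)
    simp

/-- The action of `𝔏(V)` on `𝔏(M)`:
`(a,h,b).(m,φ,n) = (hm - φa, [h,φ] + a □ n - m □ b, φ^♮ b - h^♮ n)`. -/
def act [W.Nondegenerate] (p : T.TKK) : W.L →+ W.L where
  toFun μ := (W.op p.2.1 μ.1 - μ.2.1.1 p.1,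
    W.comm p.2.1 μ.2.1 + ⟨W.tp₂ p.1 μ.2.2, W.tp₂_mem _ _⟩ - ⟨W.mBox μ.1 p.2.2, W.mBox_mem _ _⟩,
    (W.natural μ.2.1).1 p.2.2 - W.op (T.natural p.2.1) μ.2.2)
  map_zero' := by
    have h0 : W.natural 0 = 0 := by simpa using W.natural_add 0 0
    refine Prod.ext ?_ (Prod.ext (Subtype.ext (LinearMap.ext fun x => ?_)) ?_)
    · change W.op p.2.1 0 - (0 : V →ₛₗ[τ] M) p.1 = 0
      simp
    · change (W.op p.2.1 ((0 : V →ₛₗ[τ] M) x) - (0 : V →ₛₗ[τ] M) (p.2.1.1 x)) + W.tp₂ p.1 0 x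
        - W.tp₃ x p.2.2 0 = 0
      simp
    · change (W.natural 0).1 p.2.2 - W.op (T.natural p.2.1) 0 = 0
      simp [h0]
  map_add' μ ν := by
    refine Prod.ext ?_ (Prod.ext (Subtype.ext (LinearMap.ext fun x => ?_)) ?_)
    · change W.op p.2.1 (μ.1 + ν.1) - (μ.2.1.1 + ν.2.1.1) p.1 =
        (W.op p.2.1 μ.1 - μ.2.1.1 p.1) + (W.op p.2.1 ν.1 - ν.2.1.1 p.1)
      simp
      abel
    · change (W.op p.2.1 ((μ.2.1.1 + ν.2.1.1) x) - (μ.2.1.1 + ν.2.1.1) (p.2.1.1 x))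
          + W.tp₂ p.1 (μ.2.2 + ν.2.2) x - W.tp₃ x p.2.2 (μ.1 + ν.1) =
        ((W.op p.2.1 (μ.2.1.1 x) - μ.2.1.1 (p.2.1.1 x)) + W.tp₂ p.1 μ.2.2 x
          - W.tp₃ x p.2.2 μ.1) +
        ((W.op p.2.1 (ν.2.1.1 x) - ν.2.1.1 (p.2.1.1 x)) + W.tp₂ p.1 ν.2.2 x
          - W.tp₃ x p.2.2 ν.1)
      simp
      abel
    · change (W.natural (μ.2.1 + ν.2.1)).1 p.2.2 - W.op (T.natural p.2.1) (μ.2.2 + ν.2.2) =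
        ((W.natural μ.2.1).1 p.2.2 - W.op (T.natural p.2.1) μ.2.2) +
        ((W.natural ν.2.1).1 p.2.2 - W.op (T.natural p.2.1) ν.2.2)
      simp [natural_add]
      abel

/-! ### Triple derivations -/

/-- A triple derivation `ω : V → M` (linear if `τ = id`, conjugate linear if `τ = conj`):
`ω{a,b,c} = {ω(a),b,c} + {a,ω(b),c} + {a,b,ω(c)}`. -/
def IsTripleDerivation (ω : V →ₛₗ[τ] M) : Prop :=
  ∀ a b c, ω (T.tp a b c) = W.tp₃ c b (ω a) + W.tp₂ a (ω b) c + W.tp₃ a b (ω c)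

/-- An inner triple derivation `ω = ∑ᵢ (mᵢ □ vᵢ - vᵢ □ mᵢ)`. -/
def IsInner (ω : V →ₛₗ[τ] M) : Prop :=
  ∃ (k : ℕ) (m : Fin k → M) (v : Fin k → V), ω = ∑ i, (W.mBox (m i) (v i) - W.tp₂ (v i) (m i))

/-! ### Cohomology -/

/-- The space `A^k(𝔏(V),𝔏(M))` of alternating `k`-linear maps; for `k = 0` it is identified with
`𝔏(M)` through the value at the empty tuple. -/
abbrev LieCochain (k : ℕ) : Type _ := T.TKK [⋀^Fin k]→ₗ[𝕜] W.L

set_option linter.unusedSectionVars false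

variable [T.Nondegenerate] [W.Nondegenerate]

/-- The coboundary operator `d_k`, with the indices running from `0`:
`(dψ)(x₀,…,x_k) = ∑ᵢ (-1)^i xᵢ.ψ(…,x̂ᵢ,…) + ∑_{i<j} (-1)^{i+j} ψ([xᵢ,xⱼ],…,x̂ᵢ,…,x̂ⱼ,…)`. The entries
other than `xᵢ`, `xⱼ` for `i < j` are enumerated by `p ↦ x (j.succAbove (i.succAbove p))`. -/
def d : (k : ℕ) → ((Fin k → T.TKK) → W.L) → (Fin (k + 1) → T.TKK) → W.L
  | 0, ψ, x => W.act (x 0) (ψ Fin.elim0)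
  | k + 1, ψ, x =>
    ∑ i : Fin (k + 2), (-1 : ℤ) ^ (i : ℕ) • W.act (x i) (ψ fun p => x (i.succAbove p)) +
    ∑ j : Fin (k + 2), ∑ i : Fin (k + 1), if i.castSucc < j then
      (-1 : ℤ) ^ ((i : ℕ) + (j : ℕ)) •
        ψ (Fin.cons ⁅x i.castSucc, x j⁆ fun p : Fin k => x (j.succAbove (i.succAbove p)))
    else 0

theorem d_add (k : ℕ) (ψ χ : (Fin k → T.TKK) → W.L) : W.d k (ψ + χ) = W.d k ψ + W.d k χ := by
  funext x
  cases k with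
  | zero => simp [d]
  | succ k =>
    simp only [d, Pi.add_apply, map_add, smul_add, Finset.sum_add_distrib]
    have : ∀ (P : Prop) [Decidable P] (a b : W.L),
        (if P then a + b else 0) = (if P then a else 0) + (if P then b else 0) := by
      intro P _ a b; split <;> simp
    simp only [this, Finset.sum_add_distrib]
    abel

/-- `d_k` as a homomorphism of additive groups. -/
def dHom (k : ℕ) : ((Fin k → T.TKK) → W.L) →+ ((Fin (k + 1) → T.TKK) → W.L) :=
  AddMonoidHom.mk' (W.d k) (W.d_add k)

/-- The inclusion of cochains into all functions. -/
def cochainCoe (k : ℕ) : W.LieCochain k →+ ((Fin k → T.TKK) → W.L) where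
  toFun ψ := ψ
  map_zero' := rfl
  map_add' _ _ := rfl

/-- The Lie cocycles `Z^k(𝔏(V),𝔏(M)) = ker d_k`. -/
def lieZ (k : ℕ) : AddSubgroup (W.LieCochain k) := ((W.dHom k).comp (W.cochainCoe k)).ker

/-- The Lie coboundaries `B^k(𝔏(V),𝔏(M)) = im d_{k-1}`, and `B^0 = 0`. -/
def lieB : (k : ℕ) → AddSubgroup (W.LieCochain k)
  | 0 => ⊥
  | k + 1 => (((W.dHom k).comp (W.cochainCoe k)).range).comap (W.cochainCoe (k + 1))

/-- The Jordan restriction `J^k(ψ)(v₁,…,v_k)`: the first component of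
`ψ((v₁,0,0),…,(v_k,0,0)) ∈ 𝔏(M)`. -/
def J (k : ℕ) : W.LieCochain k →+ ((Fin k → V) → M) where
  toFun ψ v := (ψ fun i => ((v i, 0, 0) : V × T.V0 × V)).1
  map_zero' := rfl
  map_add' _ _ := rfl

/-- `Z^k(V,M) = J^k(Z^k(𝔏(V),𝔏(M)))`. -/
def Z (k : ℕ) : AddSubgroup ((Fin k → V) → M) := (W.lieZ k).map (W.J k)

/-- `B^k(V,M) = J^k(B^k(𝔏(V),𝔏(M)))`. -/
def B (k : ℕ) : AddSubgroup ((Fin k → V) → M) := (W.lieB k).map (W.J k)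

/-- The `k`-th cohomology group `H^k(V,M) = Z^k(V,M) / B^k(V,M)`. -/
abbrev H (k : ℕ) : Type _ := W.Z k ⧸ (W.B k).addSubgroupOf (W.Z k)

end TripleModule

end JordanTriple

end

/-! By Cartan's criterion the Killing form of the semisimple algebra `𝔏(V)` is nondegenerate, so
both Whitehead lemmas hold for its finite-dimensional modules. They are proved here over any field
of characteristic zero by induction on dimension. On an irreducible module with nonzero trace form,
an invariant tensor `∑ aᵢ ⊗ bᵢ` has a Casimir operator of nonzero trace; it is bijective by Schur's
lemma, and contraction with the tensor followed by its inverse is a contracting homotopy. If the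
trace form is zero, the action is trivial; perfectness settles degree one, and degree two reduces to
degree one with values in `L →ₗ[K] M`.

The delicate point is that `V₀` acts on `M` at all (`opWellDefined`). Commutators of the operators
`∑ {aᵢ,bᵢ,·}` on `M` depend only on the operators `∑ aᵢ □ bᵢ` on `V` (`opSum_comm_congr`). So the
operator on `M` that the middle component of `[p,q]` ought to induce can be written down without
ambiguity, and it is a 2-cocycle `opCocycle` for the trivial action. By Whitehead's second lemma
each of its scalar matrix entries is a linear function of `[p,q]`. For `p = (a,0,0)`, `q = (0,0,b)`
the bracket is `(0, a □ b, 0)` and the cocycle is `{a,b,·}`, so `∑ {aᵢ,bᵢ,m}` is determined by `∑ aᵢ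
□ bᵢ`.

Once this is known, `𝔏(M)` is a Lie module (`act_lie`). The Whitehead lemmas make every Lie cocycle
of degree one or two a coboundary, and this passes to the Jordan restrictions. A triple derivation
`ω` extends to the Lie 1-cocycle `(x,h,y) ↦ (ω x, [ω,h], ω y)`, hence to `p ↦ p.μ` for some `μ =
(m,φ,n)`. Evaluation on the two outer summands gives `ω = -φ` and `ω = φ^♮`; the average of the two
expressions is visibly inner. -/

/-! ### Casimir operators of Lie algebras with nondegenerate Killing form. -/

namespace LieModule

open scoped TensorProduct

/-- The operator `∑ aᵢ bᵢ` on a module over a Lie algebra. -/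
def casimir (K : Type*) {L : Type*} (M : Type*) [CommRing K] [LieRing L] [LieAlgebra K L]
    [AddCommGroup M] [Module K M] [LieRingModule L M] [LieModule K L M] {ι : Type*} [Fintype ι]
    (a b : ι → L) : M →ₗ[K] M := ∑ i, toEnd K L M (a i) ∘ₗ toEnd K L M (b i)

theorem casimir_apply {K L M : Type*} [CommRing K] [LieRing L] [LieAlgebra K L]
    [AddCommGroup M] [Module K M] [LieRingModule L M] [LieModule K L M] {ι : Type*} [Fintype ι]
    (a b : ι → L) (m : M) : casimir K M a b m = ∑ i, ⁅a i, ⁅b i, m⁆⁆ := by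
  simp [casimir]

set_option linter.unusedSectionVars false

variable {K L : Type*} [Field K] [CharZero K] [LieRing L] [LieAlgebra K L] [Module.Finite K L]

variable (K L) in
/-- A Lie algebra with nondegenerate Killing form is perfect. -/
theorem derivedSeries_one_eq_top_of_isKilling [LieAlgebra.IsKilling K L] :
    LieAlgebra.derivedSeries K L 1 = ⊤ := by
  set D := LieAlgebra.derivedSeries K L 1 with hD
  have h := LieIdeal.isCompl_killingCompl D
  have h0 : D.killingCompl = ⊥ := by
    rw [LieSubmodule.eq_bot_iff]
    intro x hx
    rw [LieIdeal.mem_killingCompl] at hx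
    -- By invariance, an element Killing-orthogonal to all brackets is central, and the centre is
    -- zero.
    have hc : x ∈ LieAlgebra.center K L := by
      rw [LieModule.mem_maxTrivSubmodule]
      intro y
      apply (LieAlgebra.IsKilling.killingForm_nondegenerate K L).1
      intro z
      rw [traceForm_comm, ← traceForm_apply_lie_apply]
      exact hx _ (LieSubmodule.lie_mem_lie (LieSubmodule.mem_top _) (LieSubmodule.mem_top _))
    simpa using hc
  rw [h0] at h
  exact eq_top_of_isCompl_bot h

/-- A linear map on a perfect Lie algebra is determined by its values on brackets. -/
theorem linearMap_eq_zero_of_lie [LieAlgebra.IsKilling K L] {P : Type*} [AddCommGroup P]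
    [Module K P] (f : L →ₗ[K] P) (hf : ∀ x y : L, f ⁅x, y⁆ = 0) : f = 0 := by
  rw [← LinearMap.ker_eq_top, eq_top_iff]
  have h := derivedSeries_one_eq_top_of_isKilling K L
  have h2 : (LieAlgebra.derivedSeries K L 1).toSubmodule ≤ LinearMap.ker f := by
    change (⁅(⊤ : LieIdeal K L), (⊤ : LieIdeal K L)⁆ : LieIdeal K L).toSubmodule ≤ _
    rw [LieSubmodule.lieIdeal_oper_eq_linear_span', Submodule.span_le]
    rintro _ ⟨x, -, y, -, rfl⟩
    exact hf x y
  rw [h] at h2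
  exact h2

section

variable {M : Type*} [AddCommGroup M] [Module K M] [LieRingModule L M] [LieModule K L M]

/-- If the trace form of `M` is nonzero, then there is an invariant tensor `∑ aᵢ ⊗ bᵢ` whose
Casimir operator `∑ aᵢ bᵢ` on `M` has nonzero trace. -/
theorem exists_invariant_tensor_trace_ne_zero [LieAlgebra.IsKilling K L]
    (hM : traceForm K L M ≠ 0) : ∃ (ι : Type) (_ : Fintype ι) (a b : ι → L),
      (∀ x : L, ∑ i, (⁅x, a i⁆ ⊗ₜ[K] b i + a i ⊗ₜ[K] ⁅x, b i⁆) = 0) ∧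
      LinearMap.trace K M (casimir K M a b) ≠ 0 := by
  have hinv := traceForm_lieInvariant K L M
  set β := traceForm K L M with hβ
  -- `I` is the radical of the trace form `β`. The Killing form supplies a complementary ideal `J`,
  -- and `β` is nondegenerate on `J` because `I` is `β`-orthogonal to everything. The tensor is
  -- built from a basis of `J` and its `β`-dual basis.
  let I : LieIdeal K L := LieAlgebra.InvariantForm.orthogonal β hinv ⊤
  have hI : ∀ y, y ∈ I ↔ ∀ x, β x y = 0 := fun y => by
    simp [I, LieAlgebra.InvariantForm.mem_orthogonal]
  have hcompl := LieIdeal.isCompl_killingCompl I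
  set J := I.killingCompl with hJ
  let S : Submodule K L := J.toSubmodule
  let βJ : LinearMap.BilinForm K S := β.restrict S
  have hβJ : ∀ x y : S, βJ x y = β x y := fun _ _ => rfl
  have hsymm : βJ.IsSymm := ⟨fun x y => traceForm_comm K L M x y⟩
  have hnd : βJ.Nondegenerate := by
    refine hsymm.isRefl.nondegenerate_iff_separatingLeft.mpr ?_
    intro x hx
    have hxI : (x : L) ∈ I := by
      rw [hI]
      intro y
      have hy : y ∈ I ⊔ J := by rw [hcompl.sup_eq_top]; trivial
      obtain ⟨u, hu, v, hv, rfl⟩ := (LieSubmodule.mem_sup _ _ _).mp hy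
      rw [map_add, LinearMap.add_apply, hβ, traceForm_comm, ← hβ, (hI u).mp hu, hβ,
        traceForm_comm, zero_add]
      exact hx ⟨v, hv⟩
    have : (x : L) ∈ I ⊓ J := ⟨hxI, x.2⟩
    rw [hcompl.inf_eq_bot] at this
    exact Subtype.ext (by simpa using this)
  let b := Module.finBasis K S
  let b' := βJ.dualBasis hnd b
  have hl : ∀ z : S, ∑ k, β (b' k) z • (b k : L) = z := by
    intro z
    have := b.sum_repr z
    have hc : ∀ k, b.repr z k = βJ (b' k) z := by
      intro k
      conv_rhs => rw [← this]
      simp [b', LinearMap.BilinForm.apply_dualBasis_left, -Module.Basis.sum_repr]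
    conv_rhs => rw [← this]
    simp [hc, hβJ]
  have hr : ∀ z : S, ∑ k, β z (b k) • (b' k : L) = z := by
    intro z
    have := b'.sum_repr z
    have hc : ∀ k, b'.repr z k = βJ z (b k) := by
      intro k
      exact LinearMap.BilinForm.dualBasis_repr_apply hnd b z k
    conv_rhs => rw [← this]
    simp [hc, hβJ]
  refine ⟨Fin (Module.finrank K S), inferInstance, fun i => (b i : L), fun i => (b' i : L), ?_, ?_⟩
  · intro x
    have h1 : ∀ i, ⁅x, (b i : L)⁆ = ∑ k, β (b' k) ⁅x, (b i : L)⁆ • (b k : L) := fun i =>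
      (hl ⟨⁅x, (b i : L)⁆, J.lie_mem (b i).2⟩).symm
    have h2 : ∀ i, ⁅x, (b' i : L)⁆ = ∑ k, β ⁅x, (b' i : L)⁆ (b k) • (b' k : L) := fun i =>
      (hr ⟨⁅x, (b' i : L)⁆, J.lie_mem (b' i).2⟩).symm
    rw [Finset.sum_add_distrib]
    have e1 : ∑ i, ⁅x, (b i : L)⁆ ⊗ₜ[K] (b' i : L) =
        ∑ i, ∑ k, β (b' k) ⁅x, (b i : L)⁆ • ((b k : L) ⊗ₜ[K] (b' i : L)) := by
      refine Finset.sum_congr rfl fun i _ => ?_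
      conv_lhs => rw [h1 i, TensorProduct.sum_tmul]
      simp [TensorProduct.smul_tmul']
    have e2 : ∑ i, (b i : L) ⊗ₜ[K] ⁅x, (b' i : L)⁆ =
        ∑ i, ∑ k, β ⁅x, (b' i : L)⁆ (b k) • ((b i : L) ⊗ₜ[K] (b' k : L)) := by
      refine Finset.sum_congr rfl fun i _ => ?_
      conv_lhs => rw [h2 i, TensorProduct.tmul_sum]
      simp [TensorProduct.tmul_smul]
    rw [e1, e2, Finset.sum_comm, ← Finset.sum_add_distrib]
    refine Finset.sum_eq_zero fun i _ => ?_
    rw [← Finset.sum_add_distrib]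
    refine Finset.sum_eq_zero fun k _ => ?_
    -- Invariance of `β` makes the matrices of `ad x` in the two dual bases negative transposes of
    -- each other.
    rw [hinv x (b' i) (b k), neg_smul, add_neg_cancel]
  -- Each summand has trace `β (b i) (b' i) = 1`, so the trace is `dim J`; if that were zero, the
  -- radical would be all of `L`.
  · rw [casimir, map_sum]
    have : ∀ i, LinearMap.trace K M (toEnd K L M (b i : L) ∘ₗ toEnd K L M (b' i : L)) = 1 := by
      intro i
      rw [← traceForm_apply_apply, traceForm_comm]
      have := LinearMap.BilinForm.apply_dualBasis_left (B := βJ) hnd b i i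
      simpa [hβJ] using this
    simp only [this, Finset.sum_const, Finset.card_univ, Fintype.card_fin, nsmul_eq_mul, mul_one,
      ne_eq, Nat.cast_eq_zero]
    intro h0
    apply hM
    have hJ0 : J = ⊥ := by
      rw [← LieSubmodule.toSubmodule_eq_bot]
      exact Submodule.finrank_eq_zero.mp h0
    rw [hJ0] at hcompl
    have hIt := eq_top_of_isCompl_bot hcompl
    ext x y
    exact (hI y).mp (hIt ▸ LieSubmodule.mem_top y) x

/-- If the only submodules of `M` are the trivial ones and the trace form of `M` vanishes, then the
action on `M` is trivial. -/
theorem lie_eq_zero_of_traceForm_eq_zero [LieAlgebra.IsKilling K L] [Module.Finite K M]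
    (hirr : ∀ N : LieSubmodule K L M, N = ⊥ ∨ N = ⊤) (h : traceForm K L M = 0) (x : L) (m : M) :
    ⁅x, m⁆ = 0 := by
  rcases subsingleton_or_nontrivial M with hM | hM
  · exact Subsingleton.elim _ _
  -- A vanishing trace form makes the derived algebra act nilpotently, so it kills a nonzero vector.
  -- As `L` is perfect, this vector is invariant under `L`, and by irreducibility the invariants
  -- fill `M`.
  have hn := isNilpotent_derivedSeries_of_traceForm_eq_zero h
  have hmax := nontrivial_max_triv_of_isNilpotent K (LieAlgebra.derivedSeries K L 1) M
  obtain ⟨⟨n, hn⟩, hn0⟩ := exists_ne (0 : maxTrivSubmodule K (LieAlgebra.derivedSeries K L 1) M)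
  rw [mem_maxTrivSubmodule] at hn
  have hD := derivedSeries_one_eq_top_of_isKilling K L
  have hnL : n ∈ maxTrivSubmodule K L M := by
    rw [mem_maxTrivSubmodule]
    intro y
    exact hn ⟨y, hD ▸ LieSubmodule.mem_top y⟩
  rcases hirr (maxTrivSubmodule K L M) with h1 | h1
  · rw [h1, LieSubmodule.mem_bot] at hnL
    exact absurd (Subtype.ext hnL) hn0
  · have : m ∈ maxTrivSubmodule K L M := h1 ▸ LieSubmodule.mem_top m
    exact (mem_maxTrivSubmodule K L M m).mp this x

/-- The Casimir operator of an invariant tensor commutes with the action. -/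
theorem lie_casimir {ι : Type*} [Fintype ι] {a b : ι → L}
    (hab : ∀ x : L, ∑ i, (⁅x, a i⁆ ⊗ₜ[K] b i + a i ⊗ₜ[K] ⁅x, b i⁆) = 0) (x : L) (m : M) :
    ⁅x, ∑ i, ⁅a i, ⁅b i, m⁆⁆⁆ = ∑ i, ⁅a i, ⁅b i, ⁅x, m⁆⁆⁆ := by
  -- Applying `u ⊗ v ↦ ⁅u, ⁅v, m⁆⁆` to the invariance relation gives exactly the terms that obstruct
  -- commutation.
  let B : L →ₗ[K] L →ₗ[K] M := LinearMap.mk₂ K (fun u v => ⁅u, ⁅v, m⁆⁆) (by simp) (by simp)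
    (by simp) (by simp)
  have := congrArg (TensorProduct.lift B) (hab x)
  simp only [map_sum, map_add, TensorProduct.lift.tmul, map_zero] at this
  rw [← sub_eq_zero, lie_sum, ← Finset.sum_sub_distrib, ← this]
  refine Finset.sum_congr rfl fun i _ => ?_
  simp only [B, LinearMap.mk₂_apply, leibniz_lie x (a i), leibniz_lie x (b i), lie_add]
  abel

/-- If the only submodules of `M` are the trivial ones, then either the action is trivial or some
Casimir operator is bijective. -/
theorem lie_eq_zero_or_exists_casimir_bijective [LieAlgebra.IsKilling K L] [Module.Finite K M]
    (hirr : ∀ N : LieSubmodule K L M, N = ⊥ ∨ N = ⊤) :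
    (∀ (x : L) (m : M), ⁅x, m⁆ = 0) ∨ ∃ (ι : Type) (_ : Fintype ι) (a b : ι → L),
      (∀ x : L, ∑ i, (⁅x, a i⁆ ⊗ₜ[K] b i + a i ⊗ₜ[K] ⁅x, b i⁆) = 0) ∧
      Function.Bijective (casimir K M a b) := by
  by_cases h : traceForm K L M = 0
  · exact Or.inl (lie_eq_zero_of_traceForm_eq_zero hirr h)
  right
  obtain ⟨ι, hι, a, b, hab, htr⟩ := exists_invariant_tensor_trace_ne_zero h
  refine ⟨ι, hι, a, b, hab, ?_⟩
  set C := casimir K M a b with hC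
  -- Schur's lemma: the kernel of `C` is a submodule, and it is not all of `M` since `C` has nonzero
  -- trace.
  let N : LieSubmodule K L M :=
    { LinearMap.ker C with
      lie_mem := by
        intro x m hm
        change C m = 0 at hm
        change C ⁅x, m⁆ = 0
        rw [hC, casimir_apply] at hm ⊢
        rw [← lie_casimir hab, hm, lie_zero] }
  have hinj : Function.Injective C := by
    rw [← LinearMap.ker_eq_bot]
    rcases hirr N with h1 | h1
    · exact (LieSubmodule.toSubmodule_eq_bot N).mpr h1
    · have : LinearMap.ker C = ⊤ := (LieSubmodule.toSubmodule_eq_top (N := N)).mpr h1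
      rw [LinearMap.ker_eq_top] at this
      rw [this, map_zero] at htr
      exact absurd rfl htr
  exact ⟨hinj, LinearMap.injective_iff_surjective.mp hinj⟩

/-- An auxiliary case of Whitehead's first lemma: some Casimir operator is bijective. -/
theorem exists_lie_eq_of_casimir {ι : Type*} [Fintype ι] {a b : ι → L}
    (hab : ∀ x : L, ∑ i, (⁅x, a i⁆ ⊗ₜ[K] b i + a i ⊗ₜ[K] ⁅x, b i⁆) = 0)
    (hC : Function.Bijective (casimir K M a b))
    (f : L →ₗ[K] M) (hf : ∀ x y, f ⁅x, y⁆ = ⁅x, f y⁆ - ⁅y, f x⁆) : ∃ m, ∀ x, f x = ⁅x, m⁆ := by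
  -- With `C` the Casimir operator, `m = C⁻¹ ∑ aᵢ f(bᵢ)`. The cocycle rule for `f ⁅x, bᵢ⁆` and
  -- invariance of the tensor give `C (f x) = ⁅x, C m⁆`.
  obtain ⟨m, hm⟩ := hC.2 (∑ i, ⁅a i, f (b i)⁆)
  rw [casimir_apply] at hm
  refine ⟨m, fun x => hC.1 ?_⟩
  rw [casimir_apply, casimir_apply, ← lie_casimir hab, hm]
  let B : L →ₗ[K] L →ₗ[K] M := LinearMap.mk₂ K (fun u v => ⁅u, f v⁆) (by simp) (by simp)
    (by simp) (by simp)
  have := congrArg (TensorProduct.lift B) (hab x)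
  simp only [map_sum, map_add, TensorProduct.lift.tmul, map_zero] at this
  rw [eq_comm, ← sub_eq_zero, lie_sum, ← Finset.sum_sub_distrib, ← this]
  refine Finset.sum_congr rfl fun i _ => ?_
  simp only [B, LinearMap.mk₂_apply, leibniz_lie x (a i), hf x (b i), lie_sub]
  abel

/-- An auxiliary case of Whitehead's second lemma: some Casimir operator is bijective. -/
theorem exists_coboundary_of_casimir {ι : Type*} [Fintype ι] {a b : ι → L}
    (hab : ∀ x : L, ∑ i, (⁅x, a i⁆ ⊗ₜ[K] b i + a i ⊗ₜ[K] ⁅x, b i⁆) = 0)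
    (hC : Function.Bijective (casimir K M a b))
    (f : L →ₗ[K] L →ₗ[K] M) (halt : ∀ x, f x x = 0)
    (hf : ∀ x y z, ⁅x, f y z⁆ - ⁅y, f x z⁆ + ⁅z, f x y⁆ - f ⁅x, y⁆ z + f ⁅x, z⁆ y
      - f ⁅y, z⁆ x = 0) :
    ∃ g : L →ₗ[K] M, ∀ x y, f x y = ⁅x, g y⁆ - ⁅y, g x⁆ - g ⁅x, y⁆ := by
  have hskew : ∀ x y, f x y = - f y x := fun x y => by
    have := halt (x + y)
    simp only [map_add, LinearMap.add_apply, halt, zero_add, add_zero] at this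
    rw [add_comm] at this
    exact eq_neg_of_add_eq_zero_left this
  set C := casimir K M a b with hCdef
  let e := LinearEquiv.ofBijective C hC
  -- The same homotopy one degree higher: the first argument of `f` is contracted against the
  -- tensor, then `C` is inverted.
  let g₀ : L →ₗ[K] M := ∑ i, toEnd K L M (a i) ∘ₗ f (b i)
  have hg₀ : ∀ y, g₀ y = ∑ i, ⁅a i, f (b i) y⁆ := fun y => by simp [g₀]
  let g : L →ₗ[K] M := e.symm.toLinearMap ∘ₗ g₀
  have hg : ∀ y, C (g y) = g₀ y := fun y => e.apply_symm_apply (g₀ y)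
  have hcomm : ∀ x m, C ⁅x, m⁆ = ⁅x, C m⁆ := fun x m => by
    rw [hCdef, casimir_apply, casimir_apply, lie_casimir hab]
  refine ⟨g, fun x y => hC.1 ?_⟩
  rw [map_sub, map_sub, hcomm, hcomm, hg, hg, hg, hCdef, casimir_apply]
  have key : ∀ x y : L, ⁅x, g₀ y⁆ = ∑ i, (⁅a i, ⁅x, f (b i) y⁆⁆ - ⁅a i, f ⁅x, b i⁆ y⁆) := by
    intro x y
    let B : L →ₗ[K] L →ₗ[K] M := LinearMap.mk₂ K (fun u v => ⁅u, f v y⁆) (by simp) (by simp)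
      (by simp) (by simp)
    have := congrArg (TensorProduct.lift B) (hab x)
    simp only [map_sum, map_add, TensorProduct.lift.tmul, map_zero] at this
    rw [← sub_eq_zero, hg₀, lie_sum, ← Finset.sum_sub_distrib, ← this]
    refine Finset.sum_congr rfl fun i _ => ?_
    simp only [B, LinearMap.mk₂_apply, leibniz_lie x (a i)]
    abel
  rw [key, key, hg₀, ← Finset.sum_sub_distrib, ← Finset.sum_sub_distrib]
  refine Finset.sum_congr rfl fun i _ => ?_
  rw [← lie_sub, ← lie_sub, ← lie_sub, ← lie_sub]
  congr 1
  -- After the invariance relation has been used, the claim is the cocycle identity at `(bᵢ, x, y)`,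
  -- term by term.
  have h1 := hf (b i) x y
  rw [hskew (b i) ⁅x, y⁆]
  rw [← lie_skew (b i) x, ← lie_skew (b i) y] at h1
  simp only [map_neg, LinearMap.neg_apply] at h1
  rw [← sub_eq_zero, ← h1]
  abel

end

end LieModule

/-! ### The two Whitehead lemmas. -/

namespace LieModule

open scoped TensorProduct

section

universe u v w

variable {K : Type u} {L : Type v} [Field K] [CharZero K] [LieRing L] [LieAlgebra K L]
  [Module.Finite K L] [LieAlgebra.IsKilling K L]

/-- The induction step for both Whitehead lemmas: a module has a proper nonzero submodule or is
irreducible or zero. -/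
theorem forall_eq_bot_or_top_or_exists (K : Type u) (L : Type v) [Field K] [LieRing L]
    [LieAlgebra K L] (M : Type w) [AddCommGroup M] [Module K M]
    [LieRingModule L M] [LieModule K L M] [Module.Finite K M] :
    (∀ N : LieSubmodule K L M, N = ⊥ ∨ N = ⊤) ∨ ∃ N : LieSubmodule K L M,
      Module.finrank K N < Module.finrank K M ∧
      Module.finrank K (M ⧸ N) < Module.finrank K M := by
  rw [or_iff_not_imp_left]
  intro h
  push Not at h
  obtain ⟨N, h1, h2⟩ := h
  have hs := Submodule.finrank_quotient_add_finrank N.toSubmodule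
  have e1 : Module.finrank K N < Module.finrank K M := by
    apply Submodule.finrank_lt (s := N.toSubmodule)
    rwa [ne_eq, LieSubmodule.toSubmodule_eq_top]
  have e2 : 0 < Module.finrank K N.toSubmodule := by
    rw [Nat.pos_iff_ne_zero, ne_eq, Submodule.finrank_eq_zero, LieSubmodule.toSubmodule_eq_bot]
    exact h1
  refine ⟨N, e1, ?_⟩
  change Module.finrank K (M ⧸ N.toSubmodule) < _
  omega

/-- **Whitehead's first lemma**: every 1-cocycle with values in a finite-dimensional module is a
coboundary. -/
theorem whitehead_one (M : Type w) [AddCommGroup M] [Module K M]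
    [LieRingModule L M] [LieModule K L M] [Module.Finite K M] (f : L →ₗ[K] M)
    (hf : ∀ x y : L, f ⁅x, y⁆ = ⁅x, f y⁆ - ⁅y, f x⁆) : ∃ m, ∀ x, f x = ⁅x, m⁆ := by
  rcases forall_eq_bot_or_top_or_exists K L M with hirr | ⟨N, hN, hQ⟩
  · rcases lie_eq_zero_or_exists_casimir_bijective hirr with h0 | ⟨ι, _, a, b, hab, hC⟩
    · refine ⟨0, fun x => ?_⟩
      rw [linearMap_eq_zero_of_lie f fun x y => by rw [hf, h0, h0, sub_zero]]
      simp
    · exact exists_lie_eq_of_casimir hab hC f hf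
  · let π := LieSubmodule.Quotient.mk' N
    obtain ⟨q, hq⟩ := whitehead_one (M ⧸ N) (π.toLinearMap ∘ₗ f) (fun x y => by
      simp [hf])
    obtain ⟨m, rfl⟩ := LieSubmodule.Quotient.surjective_mk' N q
    -- A lift of the solution in `M ⧸ N` corrects `f` to a cocycle with values in `N`, where
    -- induction applies again.
    have hmem : ∀ x, f x - ⁅x, m⁆ ∈ N := fun x => by
      rw [← LieSubmodule.Quotient.mk_eq_zero, map_sub, sub_eq_zero]
      change π _ = π _
      rw [LieModuleHom.map_lie]
      exact hq x
    let f' : L →ₗ[K] N :=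
      { toFun := fun x => ⟨f x - ⁅x, m⁆, hmem x⟩
        map_add' := fun x y => Subtype.ext (by simp; abel)
        map_smul' := fun c x => Subtype.ext (by simp [smul_sub]) }
    obtain ⟨n, hn⟩ := whitehead_one N f' (fun x y => Subtype.ext (by
      simp [f', hf]; abel))
    refine ⟨m + n, fun x => ?_⟩
    have := congrArg Subtype.val (hn x)
    rw [LieSubmodule.coe_bracket] at this
    rw [lie_add, ← this]
    exact (add_sub_cancel _ _).symm
termination_by Module.finrank K M

/-- Whitehead's second lemma for a module with trivial action. -/
theorem whitehead_two_of_trivial (M : Type w) [AddCommGroup M] [Module K M] [Module.Finite K M]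
    (f : L →ₗ[K] L →ₗ[K] M) (halt : ∀ x, f x x = 0)
    (hf : ∀ x y z, f ⁅x, y⁆ z + f ⁅y, z⁆ x + f ⁅z, x⁆ y = 0) :
    ∃ g : L →ₗ[K] M, ∀ x y : L, f x y = g ⁅x, y⁆ := by
  have hskew : ∀ x y, f x y = - f y x := fun x y => by
    have := halt (x + y)
    simp only [map_add, LinearMap.add_apply, halt, zero_add, add_zero] at this
    rw [add_comm] at this
    exact eq_neg_of_add_eq_zero_left this
  -- The zero action is installed on `M` so that `L →ₗ[K] M` carries the action `(x·φ)(z) = -φ ⁅x,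
  -- z⁆`. For it, the 2-cocycle `f`, read as `x ↦ f x`, is a 1-cocycle.
  let _ : LieRingModule L M :=
    { bracket := fun _ _ => 0
      add_lie := fun _ _ _ => (add_zero 0).symm
      lie_add := fun _ _ _ => (add_zero 0).symm
      leibniz_lie := fun _ _ _ => (add_zero 0).symm }
  have hz : ∀ (x : L) (m : M), ⁅x, m⁆ = 0 := fun _ _ => rfl
  let _ : LieModule K L M :=
    { smul_lie := fun _ _ _ => by rw [hz, hz, smul_zero]
      lie_smul := fun _ _ _ => by rw [hz, hz, smul_zero] }
  obtain ⟨g, hg⟩ := whitehead_one (L →ₗ[K] M) f (fun x y => by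
    ext z
    have h1 : f y ⁅x, z⁆ = f ⁅z, x⁆ y := by rw [hskew, ← lie_skew x z, map_neg]; simp
    rw [LinearMap.sub_apply, LieHom.lie_apply, LieHom.lie_apply, hz, hz, zero_sub, zero_sub,
      ← sub_eq_zero, ← hf x y z, hskew x ⁅y, z⁆, h1]
    abel)
  refine ⟨-g, fun x y => ?_⟩
  rw [hg, LieHom.lie_apply, hz, zero_sub, LinearMap.neg_apply]

/-- **Whitehead's second lemma**: every 2-cocycle with values in a finite-dimensional module is a
coboundary. -/
theorem whitehead_two (M : Type w) [AddCommGroup M] [Module K M]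
    [LieRingModule L M] [LieModule K L M] [Module.Finite K M]
    (f : L →ₗ[K] L →ₗ[K] M) (halt : ∀ x, f x x = 0)
    (hf : ∀ x y z, ⁅x, f y z⁆ - ⁅y, f x z⁆ + ⁅z, f x y⁆ - f ⁅x, y⁆ z + f ⁅x, z⁆ y
      - f ⁅y, z⁆ x = 0) :
    ∃ g : L →ₗ[K] M, ∀ x y : L, f x y = ⁅x, g y⁆ - ⁅y, g x⁆ - g ⁅x, y⁆ := by
  rcases forall_eq_bot_or_top_or_exists K L M with hirr | ⟨N, hN, hQ⟩
  · rcases lie_eq_zero_or_exists_casimir_bijective hirr with h0 | ⟨ι, _, a, b, hab, hC⟩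
    · obtain ⟨g, hg⟩ := whitehead_two_of_trivial M f halt (fun x y z => by
        have := hf x y z
        have h1 : f ⁅x, z⁆ y = - f ⁅z, x⁆ y := by rw [← lie_skew z x, map_neg]; simp
        rw [h0, h0, h0, h1] at this
        rw [← neg_eq_zero, ← this]
        abel)
      exact ⟨-g, fun x y => by simp [hg, h0]⟩
    · exact exists_coboundary_of_casimir hab hC f halt hf
  · let π := LieSubmodule.Quotient.mk' N
    obtain ⟨q, hq⟩ := whitehead_two (M ⧸ N) (f.compr₂ π.toLinearMap) (fun x => by
      simp [halt]) (fun x y z => by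
      have := congrArg π (hf x y z)
      simpa using this)
    -- Only a linear lift of the cochain `q` is needed; subtracting its coboundary from `f` leaves a
    -- cocycle with values in `N`.
    obtain ⟨g, hg⟩ := Module.projective_lifting_property π.toLinearMap q
      (LieSubmodule.Quotient.surjective_mk' N)
    have hg : ∀ x, π (g x) = q x := fun x => LinearMap.congr_fun hg x
    have hmem : ∀ x y : L, f x y - (⁅x, g y⁆ - ⁅y, g x⁆ - g ⁅x, y⁆) ∈ N := fun x y => by
      rw [← LieSubmodule.Quotient.mk_eq_zero, map_sub, sub_eq_zero]
      have := hq x y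
      change _ = π _
      rw [map_sub, map_sub, LieModuleHom.map_lie, LieModuleHom.map_lie, hg, hg, hg]
      exact this
    let f' : L →ₗ[K] L →ₗ[K] N := LinearMap.mk₂ K (fun x y => ⟨_, hmem x y⟩)
      (fun x y z => Subtype.ext (by simp; abel))
      (fun c x y => Subtype.ext (by simp [smul_sub]))
      (fun x y z => Subtype.ext (by simp; abel))
      (fun c x y => Subtype.ext (by simp [smul_sub]))
    have hf' : ∀ x y, ((f' x y : N) : M) = f x y - (⁅x, g y⁆ - ⁅y, g x⁆ - g ⁅x, y⁆) :=
      fun _ _ => rfl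
    obtain ⟨n, hn⟩ := whitehead_two N f' (fun x => Subtype.ext (by simp [hf', halt]))
      (fun x y z => Subtype.ext (by
        simp only [LieSubmodule.coe_sub, LieSubmodule.coe_add, LieSubmodule.coe_bracket, hf',
          LieSubmodule.coe_zero]
        rw [← hf x y z]
        have hj : g ⁅⁅x, y⁆, z⁆ = g ⁅x, ⁅y, z⁆⁆ - g ⁅y, ⁅x, z⁆⁆ := by
          rw [lie_lie, map_sub]
        have hj2 : g ⁅⁅x, z⁆, y⁆ = - g ⁅y, ⁅x, z⁆⁆ := by
          rw [← lie_skew, map_neg]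
        have hj3 : g ⁅⁅y, z⁆, x⁆ = - g ⁅x, ⁅y, z⁆⁆ := by
          rw [← lie_skew, map_neg]
        simp only [hj, hj2, hj3, lie_sub, leibniz_lie x y, leibniz_lie x z, leibniz_lie y z]
        abel))
    refine ⟨g + N.toSubmodule.subtype ∘ₗ n, fun x y => ?_⟩
    have := congrArg Subtype.val (hn x y)
    simp only [hf', LieSubmodule.coe_sub, LieSubmodule.coe_bracket] at this
    rw [sub_eq_iff_eq_add] at this
    rw [this]
    simp
    abel
termination_by Module.finrank K M

end

end LieModule

/-! ### Well-definedness of the action of `V₀` on `M`. -/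

noncomputable section

namespace JordanTriple

section

variable {𝕜 V : Type*} [RCLike 𝕜] [AddCommGroup V] [Module 𝕜 V] (T : JordanTriple 𝕜 V)

/-- The element `(x, h, y)` of the TKK Lie algebra. -/
def tkk (x : V) (h : T.V0) (y : V) : T.TKK := (x, h, y)

@[simp] theorem tkk_fst (x : V) (h : T.V0) (y : V) : (T.tkk x h y).1 = x := rfl
@[simp] theorem tkk_mid (x : V) (h : T.V0) (y : V) : (T.tkk x h y).2.1 = h := rfl
@[simp] theorem tkk_snd (x : V) (h : T.V0) (y : V) : (T.tkk x h y).2.2 = y := rfl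

theorem natural_zero [T.Nondegenerate] : T.natural 0 = 0 := by
  simpa using T.natural_add 0 0

end

namespace TripleModule

variable {𝕜 V M : Type*} [RCLike 𝕜] [AddCommGroup V] [Module 𝕜 V] {T : JordanTriple 𝕜 V}
  {τ : 𝕜 →+* 𝕜} [AddCommGroup M] [Module 𝕜 M] (W : T.TripleModule τ M)

set_option linter.unusedSectionVars false

@[simp] theorem opSum_nil : W.opSum [] = 0 := rfl

@[simp] theorem opSum_cons (p : V × V) (l : List (V × V)) :
    W.opSum (p :: l) = W.tp₃ p.1 p.2 + W.opSum l := by simp [opSum]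

@[simp] theorem opSum_append (l l' : List (V × V)) :
    W.opSum (l ++ l') = W.opSum l + W.opSum l' := by simp [opSum]

theorem opSum_smul (c : 𝕜) (l : List (V × V)) :
    W.opSum (l.map fun p => (c • p.1, p.2)) = τ c • W.opSum l := by
  induction l with
  | nil => simp
  | cons p l ih => simp [ih]

theorem opSum_neg (l : List (V × V)) :
    W.opSum (l.map fun p => (-p.1, p.2)) = - W.opSum l := by
  induction l with
  | nil => simp
  | cons p l ih => simp [ih]; abel

/-- The commutator of operators in the span of the `a □ b` on `M` is again of this form. -/
theorem opSum_comm_opSum (l k : List (V × V)) :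
    W.opSum l ∘ₗ W.opSum k - W.opSum k ∘ₗ W.opSum l =
      W.opSum (k.flatMap fun p =>
        [(T.boxSum l p.1, p.2), (-p.1, T.boxSum (l.map Prod.swap) p.2)]) := by
  induction k with
  | nil => simp
  | cons p k ih =>
    simp only [List.flatMap_cons, opSum_append, ← ih]
    ext m
    simp [opSum_tp₃]
    abel

/-- The commutator of the operators on `M` depends only on the operators on `V`. -/
theorem opSum_comm_congr [T.Nondegenerate] {l l' k k' : List (V × V)}
    (hl : T.boxSum l = T.boxSum l') (hk : T.boxSum k = T.boxSum k') :
    W.opSum l ∘ₗ W.opSum k - W.opSum k ∘ₗ W.opSum l =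
      W.opSum l' ∘ₗ W.opSum k' - W.opSum k' ∘ₗ W.opSum l' := by
  -- The formula `opSum_comm_opSum` sees `l` only through `∑ aᵢ □ bᵢ` and its swap, which the former
  -- determines. This frees the first argument; antisymmetry then frees the second.
  have h1 : ∀ {l l' : List (V × V)} (k : List (V × V)), T.boxSum l = T.boxSum l' →
      W.opSum l ∘ₗ W.opSum k - W.opSum k ∘ₗ W.opSum l =
        W.opSum l' ∘ₗ W.opSum k - W.opSum k ∘ₗ W.opSum l' := by
    intro l l' k h
    rw [opSum_comm_opSum, opSum_comm_opSum, h, T.boxSum_swap_congr h]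
  rw [h1 k hl, ← neg_sub, h1 l' hk, neg_sub]

/-- The commutator of the actions on `M` of `h, k ∈ V₀`. -/
def opComm (h k : T.V0) : M →ₗ[𝕜] M := W.op h ∘ₗ W.op k - W.op k ∘ₗ W.op h

section

variable [T.Nondegenerate]

theorem opComm_eq {h k : T.V0} {l l' : List (V × V)} (hl : T.boxSum l = h.1)
    (hl' : T.boxSum l' = k.1) :
    W.opComm h k = W.opSum l ∘ₗ W.opSum l' - W.opSum l' ∘ₗ W.opSum l :=
  W.opSum_comm_congr ((T.boxSum_rep h).trans hl.symm) ((T.boxSum_rep k).trans hl'.symm)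

theorem opComm_skew (h k : T.V0) : W.opComm h k = - W.opComm k h := (neg_sub _ _).symm

theorem opComm_add_left (h h' k : T.V0) :
    W.opComm (h + h') k = W.opComm h k + W.opComm h' k := by
  rw [W.opComm_eq (h := h + h') (l := T.rep h ++ T.rep h') (by simp [T.boxSum_rep])
    (T.boxSum_rep k)]
  ext m
  simp [opComm, op]
  abel

theorem opComm_smul_left (c : 𝕜) (h k : T.V0) :
    W.opComm (c • h) k = τ c • W.opComm h k := by
  rw [W.opComm_eq (h := c • h) (l := (T.rep h).map fun p => (c • p.1, p.2))
    (by simp [T.boxSum_rep, T.boxSum_smul]) (T.boxSum_rep k), opSum_smul]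
  ext m
  simp [opComm, op, smul_sub]

theorem opComm_neg_left (h k : T.V0) : W.opComm (-h) k = - W.opComm h k := by
  have h0 : W.opComm 0 k = 0 := by simpa using W.opComm_add_left 0 0 k
  apply eq_neg_of_add_eq_zero_left
  rw [← opComm_add_left, neg_add_cancel, h0]

theorem opComm_sub_left (h h' k : T.V0) :
    W.opComm (h - h') k = W.opComm h k - W.opComm h' k := by
  rw [sub_eq_add_neg, opComm_add_left, opComm_neg_left, sub_eq_add_neg]

theorem opComm_box_left (a b : V) (h : T.V0) :
    W.opComm (T.box a b) h = W.tp₃ a ((T.natural h).1 b) - W.tp₃ (h.1 a) b := by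
  rw [opComm_skew, W.opComm_eq (T.boxSum_rep h) (l' := [(a, b)]) (by simp [box]),
    opSum_comm_opSum]
  simp only [List.flatMap_cons, List.flatMap_nil, List.append_nil, opSum_cons, opSum_nil, map_neg,
    LinearMap.neg_apply, T.boxSum_rep, add_zero, JordanTriple.natural]
  abel

/-- The chosen operator for `[h,k]` need not be the commutator of those chosen for `h` and `k`, but
some expression of `[h,k]` does give that commutator, and inside `opComm` any expression may be
used. -/
theorem opComm_comm_left (h k l : T.V0) :
    W.opComm (T.comm h k) l = W.opComm h k ∘ₗ W.op l - W.op l ∘ₗ W.opComm h k := by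
  have h1 := T.comm_eq h (T.rep k)
  rw [T.boxSum_rep] at h1
  rw [W.opComm_eq (h := T.comm h k) h1.symm (T.boxSum_rep l)]
  have h2 := W.opSum_comm_opSum (T.rep h) (T.rep k)
  rw [T.boxSum_rep] at h2
  change W.opComm h k = _ at h2
  rw [h2]
  rfl

/-- The 2-cocycle on `𝔏(V)` which measures the failure of the action of `V₀` on `M` to be well
defined. -/
def opCocycle (p q : T.TKK) : M →ₗ[𝕜] M :=
  W.opComm p.2.1 q.2.1 + W.tp₃ p.1 q.2.2 - W.tp₃ q.1 p.2.2

theorem opCocycle_self (p : T.TKK) : W.opCocycle p p = 0 := by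
  simp [opCocycle, opComm]

theorem opCocycle_skew (p q : T.TKK) : W.opCocycle p q = - W.opCocycle q p := by
  rw [opCocycle, opCocycle, opComm_skew]
  abel

theorem opCocycle_add_left (p p' q : T.TKK) :
    W.opCocycle (p + p') q = W.opCocycle p q + W.opCocycle p' q := by
  simp [opCocycle, opComm_add_left]
  abel

theorem opCocycle_smul_left (c : 𝕜) (p q : T.TKK) :
    W.opCocycle (c • p) q = τ c • W.opCocycle p q := by
  simp [opCocycle, opComm_smul_left, smul_sub]

/-- The box terms cancel in pairs, and the threefold commutators cancel by the Jacobi identity for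
operators on `M`. -/
theorem opCocycle_lie (p q r : T.TKK) :
    W.opCocycle ⁅p, q⁆ r + W.opCocycle ⁅q, r⁆ p + W.opCocycle ⁅r, p⁆ q = 0 := by
  ext m
  simp only [opCocycle, bracket_fst, bracket_mid, bracket_snd, opComm_add_left, opComm_sub_left,
    opComm_box_left, opComm_comm_left, map_sub, LinearMap.add_apply, LinearMap.sub_apply,
    LinearMap.comp_apply, LinearMap.zero_apply]
  simp only [opComm, LinearMap.sub_apply, LinearMap.comp_apply, map_sub]
  abel

end

instance finiteDimensional_TKK [FiniteDimensional 𝕜 V] : FiniteDimensional 𝕜 T.TKK := by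
  -- The last summand of `𝔏(V)` carries conjugate scalars, so it is covered by a separate conjugate
  -- linear map `g`.
  let f : (V × T.V0) →ₗ[𝕜] T.TKK :=
    { toFun := fun x => T.tkk x.1 x.2 0
      map_add' := fun x y => T.TKK_ext rfl (fun _ => rfl) (add_zero 0).symm
      map_smul' := fun c x => T.TKK_ext rfl (fun _ => rfl) (smul_zero (conj c)).symm }
  let g : V →ₗ⋆[𝕜] T.TKK :=
    { toFun := fun y => T.tkk 0 0 y
      map_add' := fun x y => T.TKK_ext (add_zero 0).symm (fun _ => (add_zero 0).symm) rfl
      map_smul' := fun c x => T.TKK_ext (smul_zero (conj c)).symm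
        (fun _ => (smul_zero (conj c)).symm) (by rw [smul_snd]; simp) }
  have h : LinearMap.range f ⊔ LinearMap.range g = ⊤ := by
    rw [eq_top_iff]
    rintro x -
    refine Submodule.mem_sup.mpr ⟨f (x.1, x.2.1), ⟨_, rfl⟩, g x.2.2, ⟨_, rfl⟩, ?_⟩
    exact T.TKK_ext (add_zero _) (fun _ => add_zero _) (zero_add _)
  refine ⟨?_⟩
  rw [← h]
  exact (Module.Finite.iff_fg.mp inferInstance).sup (Module.Finite.iff_fg.mp inferInstance)

/-- The action of `V₀` on `M` is well defined if `𝔏(V)` is semisimple. -/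
theorem opWellDefined [FiniteDimensional 𝕜 V] [T.Nondegenerate] [LieAlgebra.IsSemisimple 𝕜 T.TKK]
    (hτ : τ = RingHom.id 𝕜 ∨ τ = starRingEnd 𝕜) : W.OpWellDefined := by
  have hττ : ∀ c, τ (τ c) = c := by rcases hτ with rfl | rfl <;> simp
  intro l hl
  ext m
  rw [LinearMap.zero_apply]
  rw [← Module.forall_dual_apply_eq_zero_iff 𝕜]
  intro ℓ
  have hr : ∀ p q q', W.opCocycle p (q + q') = W.opCocycle p q + W.opCocycle p q' := by
    intro p q q'
    rw [opCocycle_skew, opCocycle_add_left, W.opCocycle_skew p q, W.opCocycle_skew p q']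
    abel
  have hs : ∀ (c : 𝕜) p q, W.opCocycle p (c • q) = τ c • W.opCocycle p q := by
    intro c p q
    rw [opCocycle_skew, opCocycle_smul_left, W.opCocycle_skew p q, smul_neg]
  -- The cocycle is `τ`-linear in each argument; composing with `τ`, an involution, makes a matrix
  -- entry honestly bilinear.
  let f : T.TKK →ₗ[𝕜] T.TKK →ₗ[𝕜] 𝕜 := LinearMap.mk₂ 𝕜 (fun p q => τ (ℓ (W.opCocycle p q m)))
    (fun p p' q => by rw [opCocycle_add_left, LinearMap.add_apply, map_add, map_add])
    (fun c p q => by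
      rw [opCocycle_smul_left, LinearMap.smul_apply, map_smul, smul_eq_mul, map_mul, hττ,
        smul_eq_mul])
    (fun p q q' => by rw [hr, LinearMap.add_apply, map_add, map_add])
    (fun c p q => by
      rw [hs, LinearMap.smul_apply, map_smul, smul_eq_mul, map_mul, hττ, smul_eq_mul])
  have hf : ∀ p q, f p q = τ (ℓ (W.opCocycle p q m)) := fun _ _ => rfl
  obtain ⟨g, hg⟩ := LieModule.whitehead_two_of_trivial (L := T.TKK) 𝕜 f
    (fun p => by rw [hf, opCocycle_self]; simp)
    (fun p q r => by
      rw [hf, hf, hf, ← map_add, ← map_add, ← map_add, ← map_add, ← LinearMap.add_apply,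
        ← LinearMap.add_apply, opCocycle_lie]
      simp)
  let ι : T.V0 →+ T.TKK :=
    { toFun := fun h => T.tkk 0 h 0
      map_zero' := rfl
      map_add' := fun h k => T.TKK_ext (add_zero 0).symm (fun _ => rfl) (add_zero 0).symm }
  have hι : ∀ h, ι h = T.tkk 0 h 0 := fun _ => rfl
  -- The right side depends on `l` only through the operator on `V`. Each summand is the coboundary
  -- relation at `(a,0,0)` and `(0,0,b)`.
  have key : ∀ l : List (V × V), τ (ℓ (W.opSum l m)) = g (ι ⟨T.boxSum l, T.boxSum_mem l⟩) := by
    intro l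
    induction l with
    | nil =>
      have : (⟨T.boxSum [], T.boxSum_mem []⟩ : T.V0) = 0 := rfl
      rw [this]
      simp
    | cons p l ih =>
      have h1 : (⟨T.boxSum (p :: l), T.boxSum_mem (p :: l)⟩ : T.V0) =
          T.box p.1 p.2 + ⟨T.boxSum l, T.boxSum_mem l⟩ :=
        Subtype.ext (T.boxSum_cons p l)
      have h2 := hg (T.tkk p.1 0 0) (T.tkk 0 0 p.2)
      have h3 : ⁅T.tkk p.1 0 0, T.tkk 0 0 p.2⁆ =
          ι (T.box p.1 p.2) := by
        refine T.TKK_ext ?_ (fun x => ?_) ?_ <;> simp [hι, T.natural_zero]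
      have h4 : W.opCocycle (T.tkk p.1 0 0) (T.tkk 0 0 p.2) =
          W.tp₃ p.1 p.2 := by
        simp [opCocycle, opComm]
      rw [h1, map_add, map_add, ← ih, ← h3, ← h2, hf, h4, opSum_cons, LinearMap.add_apply, map_add,
        map_add]
  have h1 := key l
  have h2 : (⟨T.boxSum l, T.boxSum_mem l⟩ : T.V0) = 0 := Subtype.ext hl
  rw [h2, map_zero, map_zero] at h1
  exact (map_eq_zero τ).mp h1

end TripleModule

end JordanTriple

end

/-! ### The Lie module structure of `𝔏(M)`. -/

noncomputable section

namespace JordanTriple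

namespace TripleModule

variable {𝕜 V M : Type*} [RCLike 𝕜] [AddCommGroup V] [Module 𝕜 V] {T : JordanTriple 𝕜 V}
  {τ : 𝕜 →+* 𝕜} [AddCommGroup M] [Module 𝕜 M] {W : T.TripleModule τ M}

set_option linter.unusedSectionVars false

theorem OpWellDefined.op_eq (hW : W.OpWellDefined) (h : T.V0) (l : List (V × V))
    (hl : T.boxSum l = h.1) : W.op h = W.opSum l := by
  have := hW (T.rep h ++ l.map fun p => (-p.1, p.2)) (by
    rw [T.boxSum_append, T.boxSum_neg, T.boxSum_rep, hl, add_neg_cancel])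
  rw [opSum_append, opSum_neg] at this
  exact add_neg_eq_zero.mp this

theorem OpWellDefined.op_add (hW : W.OpWellDefined) (h k : T.V0) :
    W.op (h + k) = W.op h + W.op k := by
  rw [hW.op_eq (h + k) (T.rep h ++ T.rep k) (by simp [T.boxSum_rep]), opSum_append]
  rfl

theorem OpWellDefined.op_smul (hW : W.OpWellDefined) (c : 𝕜) (h : T.V0) :
    W.op (c • h) = τ c • W.op h := by
  rw [hW.op_eq (c • h) ((T.rep h).map fun p => (c • p.1, p.2))
    (by simp [T.boxSum_rep, T.boxSum_smul]), opSum_smul]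
  rfl

theorem OpWellDefined.op_zero (hW : W.OpWellDefined) : W.op 0 = 0 := by
  simpa using hW.op_add 0 0

theorem OpWellDefined.op_sub (hW : W.OpWellDefined) (h k : T.V0) :
    W.op (h - k) = W.op h - W.op k := by
  rw [eq_sub_iff_add_eq, ← hW.op_add, sub_add_cancel]

theorem OpWellDefined.op_neg (hW : W.OpWellDefined) (h : T.V0) :
    W.op (-h) = - W.op h := by
  rw [← zero_sub, hW.op_sub, hW.op_zero, zero_sub]

theorem OpWellDefined.op_box (hW : W.OpWellDefined) (a b : V) :
    W.op (T.box a b) = W.tp₃ a b := by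
  rw [hW.op_eq (T.box a b) [(a, b)] (by simp [box])]
  simp

theorem OpWellDefined.op_comm (hW : W.OpWellDefined) (h k : T.V0) (m : M) :
    W.op (T.comm h k) m = W.op h (W.op k m) - W.op k (W.op h m) := by
  have h1 := T.comm_eq h (T.rep k)
  rw [T.boxSum_rep] at h1
  have h2 := W.opSum_comm_opSum (T.rep h) (T.rep k)
  rw [T.boxSum_rep] at h2
  rw [hW.op_eq (T.comm h k) _ h1.symm]
  exact (LinearMap.congr_fun h2 m).symm

section

variable [T.Nondegenerate]

theorem OpWellDefined.op_natural (hW : W.OpWellDefined) (h : T.V0) :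
    W.op (T.natural h) = W.opSum ((T.rep h).map Prod.swap) :=
  hW.op_eq _ _ rfl

theorem OpWellDefined.op_tp₂ (hW : W.OpWellDefined) (h : T.V0) (u : V) (m : M) (x : V) :
    W.op h (W.tp₂ u m x) = W.tp₂ (h.1 u) m x - W.tp₂ u (W.op (T.natural h) m) x
      + W.tp₂ u m (h.1 x) := by
  have := W.opSum_tp₂ (T.rep h) u m x
  rwa [T.boxSum_rep, ← hW.op_natural] at this

variable (W) in
theorem op_tp₃ (h : T.V0) (x v : V) (n : M) :
    W.op h (W.tp₃ x v n) = W.tp₃ (h.1 x) v n - W.tp₃ x ((T.natural h).1 v) n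
      + W.tp₃ x v (W.op h n) := by
  have := W.opSum_tp₃ (T.rep h) x v n
  rwa [T.boxSum_rep] at this

end

variable (W)

/-- The operator `u □ m` as an element of `M₀`. -/
def box₂ (u : V) (m : M) : W.M0 := ⟨W.tp₂ u m, W.tp₂_mem u m⟩

/-- The operator `n □ v` as an element of `M₀`. -/
def box₃ (n : M) (v : V) : W.M0 := ⟨W.mBox n v, W.mBox_mem n v⟩

@[simp] theorem box₂_apply (u : V) (m : M) (x : V) : (W.box₂ u m).1 x = W.tp₂ u m x := rfl

@[simp] theorem box₃_apply (n : M) (v x : V) : (W.box₃ n v).1 x = W.tp₃ x v n := rfl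

@[simp] theorem comm_apply (h : T.V0) (φ : W.M0) (x : V) :
    (W.comm h φ).1 x = W.op h (φ.1 x) - φ.1 (h.1 x) := rfl

theorem M0_ext {φ ψ : W.M0} (h : ∀ x, φ.1 x = ψ.1 x) : φ = ψ := Subtype.ext (LinearMap.ext h)

/-- No scalar case is required, because scalars are absorbed into the module entries of the boxes.
-/
theorem M0_induction {P : W.M0 → Prop} (zero : P 0) (add : ∀ φ ψ, P φ → P ψ → P (φ + ψ))
    (h₂ : ∀ u m, P (W.box₂ u m)) (h₃ : ∀ n v, P (W.box₃ n v)) (φ : W.M0) : P φ := by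
  have key : ∀ l, P ⟨W.boxSum l, W.boxSum_mem l⟩ := by
    rintro ⟨l₁, l₂⟩
    have e : (⟨W.boxSum (l₁, l₂), W.boxSum_mem _⟩ : W.M0) =
        (l₁.map fun p => W.box₂ p.1 p.2).sum + (l₂.map fun p => W.box₃ p.1 p.2).sum := by
      apply Subtype.ext
      have e1 : ∀ l : List (V × M), ((l.map fun p => W.box₂ p.1 p.2).sum : W.M0).1 =
          (l.map fun p => W.tp₂ p.1 p.2).sum := by
        intro l
        induction l with
        | nil => rfl
        | cons p l ih => simp only [List.map_cons, List.sum_cons, Submodule.coe_add, ih]; rfl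
      have e2 : ∀ l : List (M × V), ((l.map fun p => W.box₃ p.1 p.2).sum : W.M0).1 =
          (l.map fun p => W.mBox p.1 p.2).sum := by
        intro l
        induction l with
        | nil => rfl
        | cons p l ih => simp only [List.map_cons, List.sum_cons, Submodule.coe_add, ih]; rfl
      rw [Submodule.coe_add, e1, e2]
      rfl
    rw [e]
    apply add
    · clear e
      induction l₁ with
      | nil => exact zero
      | cons p l ih => exact add _ _ (h₂ _ _) ih
    · clear e
      induction l₂ with
      | nil => exact zero
      | cons p l ih => exact add _ _ (h₃ _ _) ih
  have := key (W.rep φ)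
  simpa [boxSum_rep] using this

section

variable [W.Nondegenerate]

theorem natural_zero : W.natural 0 = 0 := by simpa using W.natural_add 0 0

theorem natural_neg (φ : W.M0) : W.natural (-φ) = -W.natural φ := by
  apply eq_neg_of_add_eq_zero_left
  rw [← natural_add, neg_add_cancel, natural_zero]

theorem natural_sub (φ ψ : W.M0) : W.natural (φ - ψ) = W.natural φ - W.natural ψ := by
  rw [sub_eq_add_neg, natural_add, natural_neg, sub_eq_add_neg]

theorem natural_smul (c : 𝕜) (φ : W.M0) : W.natural (c • φ) = conj c • W.natural φ := by
  apply Subtype.ext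
  rw [W.natural_eq (c • φ) (smulLists c (W.rep φ)) (by simp [boxSum_smul, boxSum_rep]),
    boxSum_swap_smul]
  rfl

theorem natural_natural (φ : W.M0) : W.natural (W.natural φ) = φ := by
  apply Subtype.ext
  rw [W.natural_eq (W.natural φ) (swapLists (W.rep φ)) rfl]
  simpa [swapLists] using W.boxSum_rep φ

theorem natural_box₂ (u : V) (m : M) : W.natural (W.box₂ u m) = W.box₃ m u := by
  apply Subtype.ext
  rw [W.natural_eq (W.box₂ u m) ([(u, m)], []) (by simp [box₂, boxSum])]
  simp [swapLists, boxSum, box₃]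

theorem natural_box₃ (n : M) (v : V) : W.natural (W.box₃ n v) = W.box₂ v n := by
  apply Subtype.ext
  rw [W.natural_eq (W.box₃ n v) ([], [(n, v)]) (by simp [box₃, boxSum])]
  simp [swapLists, boxSum, box₂]

end

theorem M0_tp (φ : W.M0) (c d e : V) : φ.1 (T.tp c d e) =
    W.tp₃ e d (φ.1 c) - W.tp₂ c ((W.natural φ).1 d) e + W.tp₃ c d (φ.1 e) := by
  have := W.boxSum_comm (W.rep φ) c d e
  rwa [boxSum_rep] at this

theorem comm_add (h : T.V0) (φ ψ : W.M0) : W.comm h (φ + ψ) = W.comm h φ + W.comm h ψ := by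
  apply W.M0_ext
  intro x
  simp
  abel

theorem comm_zero (h : T.V0) : W.comm h 0 = 0 := by simpa using W.comm_add h 0 0

section

variable {W} [T.Nondegenerate]

theorem OpWellDefined.comm_box₂ (hW : W.OpWellDefined) (h : T.V0) (u : V) (m : M) :
    W.comm h (W.box₂ u m) = W.box₂ (h.1 u) m - W.box₂ u (W.op (T.natural h) m) := by
  apply W.M0_ext
  intro x
  simp [hW.op_tp₂]

theorem comm_box₃ (h : T.V0) (n : M) (v : V) :
    W.comm h (W.box₃ n v) = W.box₃ (W.op h n) v - W.box₃ n ((T.natural h).1 v) := by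
  apply W.M0_ext
  intro x
  simp [op_tp₃]
  abel

/-- On generators, `♮` exchanges `u □ m` with `m □ u`, and thereby the commutator rules `comm_box₂`
and `comm_box₃`. -/
theorem OpWellDefined.natural_comm [W.Nondegenerate] (hW : W.OpWellDefined) (h : T.V0)
    (φ : W.M0) : W.natural (W.comm h φ) = - W.comm (T.natural h) (W.natural φ) := by
  induction φ using M0_induction with
  | zero => rw [comm_zero, natural_zero, comm_zero, neg_zero]
  | add φ ψ h1 h2 =>
    rw [comm_add, W.natural_add, W.natural_add, comm_add, h1, h2]
    abel
  | h₂ u m =>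
    rw [hW.comm_box₂, W.natural_sub, natural_box₂, natural_box₂, natural_box₂, comm_box₃,
      T.natural_natural]
    abel
  | h₃ n v =>
    rw [comm_box₃, W.natural_sub, natural_box₃, natural_box₃, natural_box₃, hW.comm_box₂,
      T.natural_natural]
    abel

end

section

variable {W}

theorem L_ext {μ ν : W.L} (h1 : μ.1 = ν.1) (h2 : ∀ x, μ.2.1.1 x = ν.2.1.1 x)
    (h3 : μ.2.2 = ν.2.2) : μ = ν :=
  Prod.ext h1 (Prod.ext (W.M0_ext h2) h3)

@[simp] theorem L_add_fst (μ ν : W.L) : (μ + ν).1 = μ.1 + ν.1 := rfl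
@[simp] theorem L_add_mid (μ ν : W.L) : (μ + ν).2.1 = μ.2.1 + ν.2.1 := rfl
@[simp] theorem L_add_snd (μ ν : W.L) : (μ + ν).2.2 = μ.2.2 + ν.2.2 := rfl
@[simp] theorem L_sub_fst (μ ν : W.L) : (μ - ν).1 = μ.1 - ν.1 := rfl
@[simp] theorem L_sub_mid (μ ν : W.L) : (μ - ν).2.1 = μ.2.1 - ν.2.1 := rfl
@[simp] theorem L_sub_snd (μ ν : W.L) : (μ - ν).2.2 = μ.2.2 - ν.2.2 := rfl
@[simp] theorem L_smul_fst (c : 𝕜) (μ : W.L) : (c • μ).1 = τ c • μ.1 := rfl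
@[simp] theorem L_smul_mid (c : 𝕜) (μ : W.L) : (c • μ).2.1 = τ c • μ.2.1 := rfl
@[simp] theorem L_smul_snd (c : 𝕜) (μ : W.L) : (c • μ).2.2 = conj (τ c) • μ.2.2 := rfl

variable [W.Nondegenerate]

@[simp] theorem act_fst (p : T.TKK) (μ : W.L) :
    (W.act p μ).1 = W.op p.2.1 μ.1 - μ.2.1.1 p.1 := rfl

@[simp] theorem act_mid (p : T.TKK) (μ : W.L) :
    (W.act p μ).2.1 = W.comm p.2.1 μ.2.1 + W.box₂ p.1 μ.2.2 - W.box₃ μ.1 p.2.2 := rfl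

@[simp] theorem act_snd (p : T.TKK) (μ : W.L) :
    (W.act p μ).2.2 = (W.natural μ.2.1).1 p.2.2 - W.op (T.natural p.2.1) μ.2.2 := rfl

variable [T.Nondegenerate]

theorem OpWellDefined.act_add (hW : W.OpWellDefined) (p q : T.TKK) (μ : W.L) :
    W.act (p + q) μ = W.act p μ + W.act q μ := by
  apply L_ext
  · simp [hW.op_add]; abel
  · intro x; simp [hW.op_add]; abel
  · simp [hW.op_add, T.natural_add]; abel

theorem OpWellDefined.act_smul_left (hτ : ∀ c, τ (conj c) = conj (τ c)) (hW : W.OpWellDefined)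
    (c : 𝕜) (p : T.TKK) (μ : W.L) : W.act (c • p) μ = c • W.act p μ := by
  apply L_ext
  · simp [hW.op_smul, smul_sub]
  · intro x; simp [hW.op_smul, smul_sub]
  · simp [hW.op_smul, T.natural_smul, smul_sub, hτ]

theorem act_smul (c : 𝕜) (p : T.TKK) (μ : W.L) : W.act p (c • μ) = c • W.act p μ := by
  apply L_ext
  · simp [smul_sub]
  · intro x; simp [smul_sub]
  · simp [W.natural_smul, smul_sub]

/-- The first component rests on outer symmetry and `op_comm`, the middle one on the module Jordan
identities in operator form (`M0_tp`, `op_tp₂`, `op_tp₃`). The last mirrors the first through `♮`.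
-/
theorem OpWellDefined.act_lie (hW : W.OpWellDefined) (p q : T.TKK) (μ : W.L) :
    W.act ⁅p, q⁆ μ = W.act p (W.act q μ) - W.act q (W.act p μ) := by
  apply L_ext
  · simp only [act_fst, act_mid, bracket_fst, bracket_mid, hW.op_add,
      hW.op_sub, hW.op_comm, hW.op_box, L_sub_fst, map_sub, Submodule.coe_add, Submodule.coe_sub,
      LinearMap.add_apply, LinearMap.sub_apply, comm_apply, box₂_apply, box₃_apply,
      W.tp₂_symm q.1 _ p.1]
    abel
  · intro x
    simp only [act_fst, act_mid, act_snd, bracket_fst, bracket_mid, bracket_snd, hW.op_add,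
      hW.op_sub, hW.op_comm, hW.op_box, L_sub_mid, map_sub, map_add, Submodule.coe_add,
      Submodule.coe_sub, LinearMap.add_apply, LinearMap.sub_apply, comm_apply, box₂_apply,
      box₃_apply, JordanTriple.comm_apply, JordanTriple.box_apply, M0_tp, hW.op_tp₂, op_tp₃]
    abel
  · simp only [act_mid, act_snd, bracket_mid, bracket_snd, L_sub_snd,
      T.natural_add, T.natural_sub, T.natural_comm, T.natural_box, W.natural_add, W.natural_sub,
      hW.natural_comm, natural_box₂, natural_box₃, hW.op_add, hW.op_sub, hW.op_box, map_sub,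
      Submodule.coe_add, Submodule.coe_sub, Submodule.coe_neg, LinearMap.add_apply,
      LinearMap.sub_apply, LinearMap.neg_apply, comm_apply, box₂_apply, box₃_apply,
      hW.op_neg, hW.op_comm, W.tp₂_symm q.2.2 _ p.2.2]
    abel

end

end TripleModule

end JordanTriple

end

/-! ### Vanishing of the first and second cohomology. -/

noncomputable section

namespace JordanTriple

namespace TripleModule

variable {𝕜 V M : Type*} [RCLike 𝕜] [AddCommGroup V] [Module 𝕜 V] {T : JordanTriple 𝕜 V}
  {τ : 𝕜 →+* 𝕜} [AddCommGroup M] [Module 𝕜 M] {W : T.TripleModule τ M}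

set_option linter.unusedSectionVars false

/-- The element `(m, φ, n)` of `𝔏(M)`. -/
def mkL (W : T.TripleModule τ M) (m : M) (φ : W.M0) (n : M) : W.L := (m, φ, n)

@[simp] theorem mkL_fst (m : M) (φ : W.M0) (n : M) : (W.mkL m φ n).1 = m := rfl
@[simp] theorem mkL_mid (m : M) (φ : W.M0) (n : M) : (W.mkL m φ n).2.1 = φ := rfl
@[simp] theorem mkL_snd (m : M) (φ : W.M0) (n : M) : (W.mkL m φ n).2.2 = n := rfl

theorem finiteDimensional_M0 [FiniteDimensional 𝕜 V] [FiniteDimensional 𝕜 M] :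
    FiniteDimensional 𝕜 W.M0 := by
  let b := Module.finBasis 𝕜 V
  let f : W.M0 →ₗ[𝕜] (Fin (Module.finrank 𝕜 V) → M) :=
    { toFun := fun φ i => φ.1 (b i)
      map_add' := fun _ _ => rfl
      map_smul' := fun _ _ => rfl }
  refine FiniteDimensional.of_injective f ?_
  intro φ ψ h
  exact Subtype.ext (b.ext fun i => congrFun h i)

/-- The summands carry scalars twisted in two ways, so `𝔏(M)` is written as the sum of the ranges of
two maps, semilinear for `τ` and for `τ ∘ conj`. -/
theorem finiteDimensional_L [FiniteDimensional 𝕜 V] [FiniteDimensional 𝕜 M]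
    (hττ : ∀ c, τ (τ c) = c) (hconj : ∀ c, τ (conj c) = conj (τ c)) :
    FiniteDimensional 𝕜 W.L := by
  have : FiniteDimensional 𝕜 W.M0 := finiteDimensional_M0
  have : RingHomSurjective τ := ⟨fun c => ⟨τ c, hττ c⟩⟩
  have : RingHomSurjective (τ.comp (starRingEnd 𝕜)) := ⟨fun c => ⟨conj (τ c), by simp [hττ]⟩⟩
  let f : (M × W.M0) →ₛₗ[τ] W.L :=
    { toFun := fun x => W.mkL x.1 x.2 0
      map_add' := fun x y => L_ext rfl (fun _ => rfl) (add_zero 0).symm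
      map_smul' := fun c x => L_ext (by rw [L_smul_fst]; simp [hττ])
        (fun _ => by rw [L_smul_mid]; simp [hττ])
        (smul_zero _).symm }
  let g : M →ₛₗ[τ.comp (starRingEnd 𝕜)] W.L :=
    { toFun := fun y => W.mkL 0 0 y
      map_add' := fun x y => L_ext (add_zero 0).symm (fun _ => (add_zero 0).symm) rfl
      map_smul' := fun c x => L_ext (smul_zero _).symm
        (fun _ => (smul_zero _).symm) (by rw [L_smul_snd]; simp [hττ, hconj]) }
  have h : LinearMap.range f ⊔ LinearMap.range g = ⊤ := by
    rw [eq_top_iff]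
    rintro x -
    refine Submodule.mem_sup.mpr ⟨f (x.1, x.2.1), ⟨_, rfl⟩, g x.2.2, ⟨_, rfl⟩, ?_⟩
    exact L_ext (add_zero _) (fun _ => add_zero _) (zero_add _)
  refine ⟨?_⟩
  rw [← h]
  exact (Module.Finite.iff_fg.mp inferInstance).sup (Module.Finite.iff_fg.mp inferInstance)

section

variable [T.Nondegenerate] [W.Nondegenerate]

/-- If the action of `V₀` on `M` is well defined, then `𝔏(M)` is a Lie module over `𝔏(V)`. -/
abbrev OpWellDefined.lieRingModule (hW : W.OpWellDefined) : LieRingModule T.TKK W.L where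
  bracket p μ := W.act p μ
  add_lie := hW.act_add
  lie_add p := (W.act p).map_add
  leibniz_lie p q μ := by
    change W.act p (W.act q μ) = W.act ⁅p, q⁆ μ + W.act q (W.act p μ)
    rw [hW.act_lie, sub_add_cancel]

section

variable [FiniteDimensional 𝕜 V] [FiniteDimensional 𝕜 M] [LieAlgebra.IsSemisimple 𝕜 T.TKK]

/-- Whitehead's first lemma for the module `𝔏(M)`. -/
theorem exists_eq_act (hτ : τ = RingHom.id 𝕜 ∨ τ = starRingEnd 𝕜) (f : T.TKK →ₗ[𝕜] W.L)
    (hf : ∀ p q : T.TKK, f ⁅p, q⁆ = W.act p (f q) - W.act q (f p)) :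
    ∃ μ, ∀ p, f p = W.act p μ := by
  have hττ : ∀ c, τ (τ c) = c := by rcases hτ with rfl | rfl <;> simp
  have hconj : ∀ c, τ (conj c) = conj (τ c) := by rcases hτ with rfl | rfl <;> simp
  have hW := W.opWellDefined hτ
  have : FiniteDimensional 𝕜 W.L := finiteDimensional_L hττ hconj
  let _ : LieRingModule T.TKK W.L := hW.lieRingModule
  have : LieModule 𝕜 T.TKK W.L :=
    { smul_lie := hW.act_smul_left hconj
      lie_smul := act_smul }
  exact LieModule.whitehead_one W.L f hf

/-- Whitehead's second lemma for the module `𝔏(M)`. -/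
theorem exists_eq_coboundary (hτ : τ = RingHom.id 𝕜 ∨ τ = starRingEnd 𝕜)
    (f : T.TKK →ₗ[𝕜] T.TKK →ₗ[𝕜] W.L) (halt : ∀ p, f p p = 0)
    (hf : ∀ p q r, W.act p (f q r) - W.act q (f p r) + W.act r (f p q) - f ⁅p, q⁆ r
      + f ⁅p, r⁆ q - f ⁅q, r⁆ p = 0) :
    ∃ g : T.TKK →ₗ[𝕜] W.L, ∀ p q : T.TKK,
      f p q = W.act p (g q) - W.act q (g p) - g ⁅p, q⁆ := by
  have hττ : ∀ c, τ (τ c) = c := by rcases hτ with rfl | rfl <;> simp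
  have hconj : ∀ c, τ (conj c) = conj (τ c) := by rcases hτ with rfl | rfl <;> simp
  have hW := W.opWellDefined hτ
  have : FiniteDimensional 𝕜 W.L := finiteDimensional_L hττ hconj
  let _ : LieRingModule T.TKK W.L := hW.lieRingModule
  have : LieModule 𝕜 T.TKK W.L :=
    { smul_lie := hW.act_smul_left hconj
      lie_smul := act_smul }
  exact LieModule.whitehead_two W.L f halt hf

end

theorem d_one_apply (ψ : (Fin 1 → T.TKK) → W.L) (p q : T.TKK) :
    W.d 1 ψ ![p, q] = W.act p (ψ fun _ => q) - W.act q (ψ fun _ => p) - ψ fun _ => ⁅p, q⁆ := by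
  have e0 : (fun i => ![p, q] (Fin.succAbove 0 i)) = fun _ => q := by
    funext i; fin_cases i; rfl
  have e1 : (fun i => ![p, q] (Fin.succAbove 1 i)) = fun _ => p := by
    funext i; fin_cases i; rfl
  have e2 : ∀ t : Fin 0 → T.TKK, (Fin.cons ⁅p, q⁆ t : Fin 1 → T.TKK) = fun _ => ⁅p, q⁆ := by
    intro t; funext i; fin_cases i; rfl
  have h : W.d 1 ψ ![p, q] =
      ∑ i : Fin 2, (-1 : ℤ) ^ (i : ℕ) • W.act (![p, q] i) (ψ fun t => ![p, q] (i.succAbove t)) +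
      ∑ j : Fin 2, ∑ i : Fin 1, if i.castSucc < j then (-1 : ℤ) ^ ((i : ℕ) + (j : ℕ)) •
        ψ (Fin.cons ⁅![p, q] i.castSucc, ![p, q] j⁆ fun t : Fin 0 =>
          ![p, q] (j.succAbove (i.succAbove t))) else 0 := rfl
  rw [h, Fin.sum_univ_two, e0, e1]
  simp [e2]
  abel

theorem d_two_apply (ψ : (Fin 2 → T.TKK) → W.L) (p q r : T.TKK) :
    W.d 2 ψ ![p, q, r] = W.act p (ψ ![q, r]) - W.act q (ψ ![p, r]) + W.act r (ψ ![p, q])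
      - ψ ![⁅p, q⁆, r] + ψ ![⁅p, r⁆, q] - ψ ![⁅q, r⁆, p] := by
  have e0 : (fun i => ![p, q, r] (Fin.succAbove 0 i)) = ![q, r] := by
    funext i; fin_cases i <;> rfl
  have e1 : (fun i => ![p, q, r] (Fin.succAbove 1 i)) = ![p, r] := by
    funext i; fin_cases i <;> rfl
  have e2 : (fun i => ![p, q, r] (Fin.succAbove 2 i)) = ![p, q] := by
    funext i; fin_cases i <;> rfl
  have c1 : (Fin.cons ⁅p, q⁆ fun i : Fin 1 => ![p, q, r] (Fin.succAbove 1 (Fin.succAbove 0 i)) :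
      Fin 2 → T.TKK) = ![⁅p, q⁆, r] := by
    funext i; fin_cases i <;> rfl
  have c2 : (Fin.cons ⁅p, r⁆ fun i : Fin 1 => ![p, q, r] (Fin.succAbove 2 (Fin.succAbove 0 i)) :
      Fin 2 → T.TKK) = ![⁅p, r⁆, q] := by
    funext i; fin_cases i <;> rfl
  have c3 : (Fin.cons ⁅q, r⁆ fun i : Fin 1 => ![p, q, r] (Fin.succAbove 2 (Fin.succAbove 1 i)) :
      Fin 2 → T.TKK) = ![⁅q, r⁆, p] := by
    funext i; fin_cases i <;> rfl
  have l1 : ((0 : Fin 2).castSucc < (0 : Fin 3)) = False := by decide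
  have l2 : ((1 : Fin 2).castSucc < (0 : Fin 3)) = False := by decide
  have l3 : ((0 : Fin 2).castSucc < (1 : Fin 3)) = True := by decide
  have l4 : ((1 : Fin 2).castSucc < (1 : Fin 3)) = False := by decide
  have l5 : ((0 : Fin 2).castSucc < (2 : Fin 3)) = True := by decide
  have l6 : ((1 : Fin 2).castSucc < (2 : Fin 3)) = True := by decide
  have v0 : ![p, q, r] (0 : Fin 2).castSucc = p := rfl
  have v1 : ![p, q, r] (1 : Fin 2).castSucc = q := rfl
  have w0 : ![p, q, r] 0 = p := rfl
  have w1 : ![p, q, r] 1 = q := rfl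
  have w2 : ![p, q, r] 2 = r := rfl
  have h : W.d 2 ψ ![p, q, r] =
      ∑ i : Fin 3, (-1 : ℤ) ^ (i : ℕ) •
        W.act (![p, q, r] i) (ψ fun t => ![p, q, r] (i.succAbove t)) +
      ∑ j : Fin 3, ∑ i : Fin 2, if i.castSucc < j then (-1 : ℤ) ^ ((i : ℕ) + (j : ℕ)) •
        ψ (Fin.cons ⁅![p, q, r] i.castSucc, ![p, q, r] j⁆ fun t : Fin 1 =>
          ![p, q, r] (j.succAbove (i.succAbove t))) else 0 := rfl
  rw [h]
  simp only [Fin.sum_univ_three, Fin.sum_univ_two, e0, e1, e2, l1, l2, l3, l4, l5, l6, if_true,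
    if_false, v0, v1, w0, w1, w2, c1, c2, c3]
  norm_num
  abel

/-- The cocycles are coboundaries in degree `k + 1` if every cocycle is the coboundary of a
cochain. -/
theorem subsingleton_H_of_exists (k : ℕ) (h : ∀ ψ : W.LieCochain (k + 1), W.d (k + 1) ψ = 0 →
    ∃ χ : W.LieCochain k, W.d k χ = ψ) : Subsingleton (W.H (k + 1)) := by
  rw [QuotientAddGroup.subsingleton_iff, AddSubgroup.addSubgroupOf_eq_top]
  -- Both groups are images under the same `J`, so it suffices to compare Lie cocycles with Lie
  -- coboundaries.
  refine AddSubgroup.map_mono fun ψ hψ => ?_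
  obtain ⟨χ, hχ⟩ := h ψ hψ
  exact ⟨χ, hχ⟩

section

variable [FiniteDimensional 𝕜 V] [FiniteDimensional 𝕜 M] [LieAlgebra.IsSemisimple 𝕜 T.TKK]

theorem subsingleton_H_one (hτ : τ = RingHom.id 𝕜 ∨ τ = starRingEnd 𝕜) :
    Subsingleton (W.H 1) := by
  refine subsingleton_H_of_exists 0 fun ψ hψ => ?_
  let f : T.TKK →ₗ[𝕜] W.L :=
    { toFun := fun p => ψ ![p]
      map_add' := fun p q => ψ.map_vecCons_add _ _ _
      map_smul' := fun c p => ψ.map_vecCons_smul _ _ _ }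
  have hf : ∀ p, f p = ψ fun _ => p := fun p => congrArg ψ (by funext i; fin_cases i; rfl)
  obtain ⟨μ, hμ⟩ := exists_eq_act hτ f fun p q => by
    have := congrFun hψ ![p, q]
    rw [d_one_apply, ← hf, ← hf, ← hf, Pi.zero_apply] at this
    exact (sub_eq_zero.mp this).symm
  -- A 0-cochain is a constant, here the element `μ` from Whitehead's first lemma.
  refine ⟨AlternatingMap.constOfIsEmpty 𝕜 T.TKK (Fin 0) μ, ?_⟩
  funext x
  change W.act (x 0) μ = ψ x
  rw [← hμ, hf]
  exact congrArg ψ (by funext i; fin_cases i; rfl)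

theorem subsingleton_H_two (hτ : τ = RingHom.id 𝕜 ∨ τ = starRingEnd 𝕜) :
    Subsingleton (W.H 2) := by
  refine subsingleton_H_of_exists 1 fun ψ hψ => ?_
  let f : T.TKK →ₗ[𝕜] T.TKK →ₗ[𝕜] W.L := LinearMap.mk₂ 𝕜 (fun p q => ψ ![p, q])
    (fun p p' q => ψ.map_vecCons_add _ _ _) (fun c p q => ψ.map_vecCons_smul _ _ _)
    (fun p q q' => (ψ.curryLeft p).map_vecCons_add _ _ _)
    (fun c p q => (ψ.curryLeft p).map_vecCons_smul _ _ _)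
  have hf : ∀ p q, f p q = ψ ![p, q] := fun _ _ => rfl
  obtain ⟨g, hg⟩ := exists_eq_coboundary hτ f
    (fun p => ψ.map_eq_zero_of_eq ![p, p] (i := 0) (j := 1) rfl (by decide))
    (fun p q r => by
      have := congrFun hψ ![p, q, r]
      rwa [d_two_apply] at this)
  refine ⟨AlternatingMap.ofSubsingleton 𝕜 T.TKK W.L (0 : Fin 1) g, ?_⟩
  funext x
  have hx : x = ![x 0, x 1] := by funext i; fin_cases i <;> rfl
  rw [hx, d_one_apply, ← hf, hg]
  rfl

end

end

end TripleModule

end JordanTriple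

end

/-! ### Triple derivations are inner. -/

noncomputable section

namespace JordanTriple

namespace TripleModule

variable {𝕜 V M : Type*} [RCLike 𝕜] [AddCommGroup V] [Module 𝕜 V] {T : JordanTriple 𝕜 V}
  {τ : 𝕜 →+* 𝕜} [AddCommGroup M] [Module 𝕜 M] {W : T.TripleModule τ M}

set_option linter.unusedSectionVars false

/-- The commutator of a triple derivation with `∑ aᵢ □ bᵢ`. -/
theorem IsTripleDerivation.comp_boxSum_sub {ω : V →ₛₗ[τ] M} (hω : W.IsTripleDerivation ω)
    (l : List (V × V)) : ω.comp (T.boxSum l) - (W.opSum l).comp ω =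
      W.boxSum (l.map fun p => (p.1, ω p.2), l.map fun p => (ω p.1, p.2)) := by
  ext x
  induction l with
  | nil => simp [boxSum]
  | cons p l ih =>
    simp only [boxSum, LinearMap.sub_apply, LinearMap.comp_apply, LinearMap.add_apply,
      List.map_cons, List.sum_cons] at ih ⊢
    simp only [JordanTriple.boxSum_cons, opSum_cons, LinearMap.add_apply, map_add, hω p.1 p.2 x,
      mBox_apply]
    rw [← sub_eq_zero] at ih ⊢
    rw [← ih]
    abel

/-- The commutator `[ω, h] ∈ M₀` of a triple derivation `ω` with `h ∈ V₀`. -/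
def IsTripleDerivation.comm {ω : V →ₛₗ[τ] M} (hω : W.IsTripleDerivation ω) (h : T.V0) : W.M0 :=
  ⟨ω.comp h.1 - (W.op h).comp ω, by
    rw [← T.boxSum_rep h]
    exact hω.comp_boxSum_sub (T.rep h) ▸ W.boxSum_mem _⟩

theorem IsTripleDerivation.comm_apply {ω : V →ₛₗ[τ] M} (hω : W.IsTripleDerivation ω) (h : T.V0)
    (x : V) : (hω.comm h).1 x = ω (h.1 x) - W.op h (ω x) := rfl

section

variable [T.Nondegenerate] [W.Nondegenerate]

/-- By the derivation rule `[ω,h] = ∑ (ω aᵢ □ bᵢ + aᵢ □ ω bᵢ)`, an expression which is symmetric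
under swapping every `aᵢ` with `bᵢ`. -/
theorem IsTripleDerivation.natural_comm {ω : V →ₛₗ[τ] M} (hω : W.IsTripleDerivation ω)
    (hW : W.OpWellDefined) (h : T.V0) : W.natural (hω.comm h) = hω.comm (T.natural h) := by
  apply Subtype.ext
  have h1 := hω.comp_boxSum_sub (T.rep h)
  rw [T.boxSum_rep] at h1
  have h2 := hω.comp_boxSum_sub ((T.rep h).map Prod.swap)
  rw [← hW.op_natural] at h2
  rw [W.natural_eq _ _ h1.symm]
  refine Eq.trans ?_ h2.symm
  simp [swapLists, Function.comp_def]

/-- The extension of a triple derivation to a map `𝔏(V) → 𝔏(M)`. -/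
def IsTripleDerivation.extend {ω : V →ₛₗ[τ] M} (hω : W.IsTripleDerivation ω)
    (hW : W.OpWellDefined) (hconj : ∀ c, τ (conj c) = conj (τ c)) : T.TKK →ₗ[𝕜] W.L where
  toFun p := W.mkL (ω p.1) (hω.comm p.2.1) (ω p.2.2)
  map_add' p q := by
    apply L_ext
    · simp
    · intro x
      simp [hω.comm_apply, hW.op_add]
      abel
    · simp
  map_smul' c p := by
    apply L_ext
    · simp
    · intro x
      simp [hω.comm_apply, hW.op_smul, smul_sub]
    · simp [hconj]

/-- The derivation rule is needed for the box terms of the middle component; the last component uses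
`[ω,h]^♮ = [ω,h^♮]`. -/
theorem IsTripleDerivation.extend_lie {ω : V →ₛₗ[τ] M} (hω : W.IsTripleDerivation ω)
    (hW : W.OpWellDefined) (hconj : ∀ c, τ (conj c) = conj (τ c)) (p q : T.TKK) :
    hω.extend hW hconj ⁅p, q⁆ =
      W.act p (hω.extend hW hconj q) - W.act q (hω.extend hW hconj p) := by
  have e : ∀ p, hω.extend hW hconj p = W.mkL (ω p.1) (hω.comm p.2.1) (ω p.2.2) := fun _ => rfl
  rw [e, e, e]
  apply L_ext
  · simp only [mkL_fst, mkL_mid, bracket_fst, L_sub_fst, act_fst, hω.comm_apply, map_sub]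
    abel
  · intro x
    simp only [mkL_fst, mkL_mid, mkL_snd, bracket_mid, L_sub_mid, act_mid, hω.comm_apply, map_sub,
      map_add, Submodule.coe_sub, Submodule.coe_add, LinearMap.sub_apply, LinearMap.add_apply,
      JordanTriple.comm_apply, JordanTriple.box_apply, W.comm_apply, box₂_apply, box₃_apply,
      hW.op_add, hW.op_sub, hW.op_comm, hW.op_box, hω p.1, hω q.1]
    abel
  · simp only [mkL_mid, mkL_snd, bracket_snd, L_sub_snd, act_snd, hω.natural_comm hW,
      hω.comm_apply, map_sub]
    abel

end

theorem isInner_of_list (l : List (M × V)) :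
    W.IsInner (l.map fun p => W.mBox p.1 p.2 - W.tp₂ p.2 p.1).sum := by
  refine ⟨l.length, fun i => (l.get i).1, fun i => (l.get i).2, ?_⟩
  rw [← List.sum_ofFn]
  congr 1
  conv_lhs => rw [← List.ofFn_get l, List.map_ofFn]
  rfl

/-- If `ω = -φ = φ^♮`, then `ω = ½(φ^♮ - φ)`, in which every box is paired with the negative of its
swap. The factor `½` is real, so it moves into the module entry in either position. -/
theorem isInner_of_boxSum (l : List (V × M) × List (M × V)) (ω : V →ₛₗ[τ] M)
    (h1 : ω = - W.boxSum l) (h2 : ω = W.boxSum (swapLists l)) : W.IsInner ω := by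
  obtain ⟨l₁, l₂⟩ := l
  have hc : conj (2⁻¹ : 𝕜) = 2⁻¹ := by rw [map_inv₀, map_ofNat]
  have h : ω = (2⁻¹ : 𝕜) • (W.boxSum (swapLists (l₁, l₂)) - W.boxSum (l₁, l₂)) := by
    rw [sub_eq_add_neg, ← h1, ← h2, ← two_smul 𝕜 ω, smul_smul,
      inv_mul_cancel₀ two_ne_zero, one_smul]
  have e1 : ∀ l : List (V × M), (2⁻¹ : 𝕜) • (((l.map Prod.swap).map fun p => W.mBox p.1 p.2).sum
      - (l.map fun p => W.tp₂ p.1 p.2).sum) = ((l.map fun p => ((2⁻¹ : 𝕜) • p.2, p.1)).map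
        fun p => W.mBox p.1 p.2 - W.tp₂ p.2 p.1).sum := by
    intro l
    induction l with
    | nil => simp
    | cons p l ih =>
      simp only [List.map_cons, List.sum_cons, ← ih]
      ext x
      simp [hc, smul_sub]
      abel
  have e2 : ∀ l : List (M × V), (2⁻¹ : 𝕜) • (((l.map Prod.swap).map fun p => W.tp₂ p.1 p.2).sum
      - (l.map fun p => W.mBox p.1 p.2).sum) = ((l.map fun p => (-(2⁻¹ : 𝕜) • p.1, p.2)).map
        fun p => W.mBox p.1 p.2 - W.tp₂ p.2 p.1).sum := by
    intro l
    induction l with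
    | nil => simp
    | cons p l ih =>
      simp only [List.map_cons, List.sum_cons, ← ih]
      ext x
      simp [hc, smul_sub]
      abel
  have h3 : ω = (((l₁.map fun p => ((2⁻¹ : 𝕜) • p.2, p.1)) ++
      l₂.map fun p => (-(2⁻¹ : 𝕜) • p.1, p.2)).map
        fun p => W.mBox p.1 p.2 - W.tp₂ p.2 p.1).sum := by
    rw [List.map_append, List.sum_append, ← e1, ← e2, h, ← smul_add]
    simp only [boxSum, swapLists]
    congr 1
    abel
  rw [h3]
  exact isInner_of_list _

theorem IsTripleDerivation.isInner [T.Nondegenerate] [W.Nondegenerate] [FiniteDimensional 𝕜 V]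
    [FiniteDimensional 𝕜 M] [LieAlgebra.IsSemisimple 𝕜 T.TKK]
    (hτ : τ = RingHom.id 𝕜 ∨ τ = starRingEnd 𝕜) {ω : V →ₛₗ[τ] M}
    (hω : W.IsTripleDerivation ω) : W.IsInner ω := by
  have hW := W.opWellDefined hτ
  have hconj : ∀ c, τ (conj c) = conj (τ c) := by rcases hτ with rfl | rfl <;> simp
  obtain ⟨μ, hμ⟩ := exists_eq_act hτ (hω.extend hW hconj) (hω.extend_lie hW hconj)
  -- Only the middle component `φ` of `μ` matters: at `(a,0,0)` the first component of the action is
  -- `-φ a`, and at `(0,0,b)` the last one is `φ^♮ b`.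
  apply isInner_of_boxSum (W.rep μ.2.1)
  · rw [boxSum_rep]
    ext a
    have : ω a = (W.act (T.tkk a 0 0) μ).1 :=
      congrArg (fun ν : W.L => ν.1) (hμ (T.tkk a 0 0))
    rw [this]
    simp [hW.op_zero]
  · ext b
    have : ω b = (W.act (T.tkk 0 0 b) μ).2.2 :=
      congrArg (fun ν : W.L => ν.2.2) (hμ (T.tkk 0 0 b))
    rw [this]
    simp [hW.op_zero, T.natural_zero]
    rfl

end TripleModule

end JordanTriple

end

theorem corollary5p2 {𝕜 V M : Type*} [RCLike 𝕜]
    [AddCommGroup V] [Module 𝕜 V] [FiniteDimensional 𝕜 V]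
    [AddCommGroup M] [Module 𝕜 M] [FiniteDimensional 𝕜 M]
    (T : JordanTriple 𝕜 V) [T.Nondegenerate] [LieAlgebra.IsSemisimple 𝕜 T.TKK]
    (τ : 𝕜 →+* 𝕜) (hτ : τ = RingHom.id 𝕜 ∨ τ = starRingEnd 𝕜)
    (W : T.TripleModule τ M) [W.Nondegenerate] :
    W.OpWellDefined ∧ Subsingleton (W.H 1) ∧ Subsingleton (W.H 2) ∧
      ∀ ω : V →ₛₗ[τ] M, W.IsTripleDerivation ω → W.IsInner ω :=
  ⟨W.opWellDefined hτ, JordanTriple.TripleModule.subsingleton_H_one hτ,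
    JordanTriple.TripleModule.subsingleton_H_two hτ, fun _ hω => hω.isInner hτ⟩
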